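/- Let $P$ be a finite ranked poset, i.e. a finite partially ordered set with a height function $h : P \to \{0,1,2,\dots\}$ that vanishes on all minimal elements and increases by exactly $1$ along each covering relation. Let $V_0$ and $V_1$ be the sets of elements of even and odd height. Say that $r : P \to \{1,2,3,\dots\}$ satisfies the order condition if $r$ is non-decreasing and $r(x) < r(y)$ whenever $x <_P y$ and $x$ has odd height. Put $$F_P(x_1,x_2,\dots) = \sum_{r} \prod_{v \in P} x_{r(v)}, \qquad N_P\begin{pmatrix} p_1 & p_2 & \dots\\ q_1 & q_2 & \dots\end{pmatrix} = \sum_{r} \prod_{v \in V_0} p_{r(v)} \prod_{v \in V_1} q_{r(v)},$$ where both sums run over the functions $r$ satisfying the order condition. For a composition $I=(i_1,\dots,i_r)$ (a finite sequence of positive integers) let $M_I = \sum_{a_1<\dots<a_r} x_{a_1}^{i_1}\cdots x_{a_r}^{i_r}$, and let $\mathrm{QSym}$ be the $\mathbb{Q}$-vector space with basis $(M_I)_I$. For $m \ge 0$ let $$x_{2i+1} = q_{i+1}+\dots+q_m + p_{i+1}+\dots+p_{m+1} \quad (0 \le i \le m), \qquad x_{2i} = q_i + \dots + q_m + p_{i+1}+\dots+p_{m+1}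 \quad (1 \le i \le m),$$ and let $\mathbb{X}_m = \ominus(x_1)\oplus(x_2)\ominus(x_3)\oplus\dots\ominus(x_{2m+1})$; that is, $F \mapsto F(\mathbb{X}_m)$ is the $\mathbb{Q}$-linear map $\mathrm{QSym} \to \mathbb{Q}[p_1,\dots,p_{m+1},q_1,\dots,q_m]$ whose values $M_I(\mathbb{X}_m)$ are defined by $$\sum_{I} M_I(\mathbb{X}_m)\, S_{i_1} S_{i_2}\cdots S_{i_r} = \sigma_{x_1}^{-1}\,\sigma_{x_2}\,\sigma_{x_3}^{-1}\cdots \sigma_{x_{2m}}\,\sigma_{x_{2m+1}}^{-1}, \qquad \sigma_x = 1 + \sum_{n\ge 1} S_n x^n,$$ where $S_1,S_2,\dots$ are free noncommuting variables, $S_n$ having degree $n$. Then $F_P \in \mathrm{QSym}$, and for every $m \ge 0$ $$N_P\begin{pmatrix} p_1 & \dots & p_m & p_{m+1} & 0 & \dots\\ q_1 & \dots & q_m & 0 & 0 & \dots\end{pmatrix} = (-1)^{|V_0|}\, F_P(\mathbb{X}_m).$$ Moreover, $N_P$ is the only formal power series in $p_1,p_2,\dots,q_1,q_2,\dots$ over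 $\mathbb{Q}$ that has these specializations for all $m \ge 0$; and $N_P$ is determined by $F_P$: if $Q$ is a finite ranked poset with $F_Q = F_P$, then $N_Q = N_P$. -/

import Mathlib

noncomputable section

namespace SuperQSym

/-! ### Quasi-symmetric functions

The variable `X i` (`i : ℕ`) of `MvPowerSeries ℕ ℚ` is the variable `x_{i+1}`: the index set
`{1, 2, 3, …}` is shifted by one, here and below. -/

/-- A composition: a finite sequence of positive integers. -/
abbrev Comp : Type := List ℕ+

/-- The monomial quasi-symmetric function
`M_I = ∑_{a_1 < ⋯ < a_r} x_{a_1}^{i_1} ⋯ x_{a_r}^{i_r}`, given coefficient by coefficient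
(for each monomial `d`, at most one term of the sum is non-zero). -/
def monomialQSym (I : Comp) : MvPowerSeries ℕ ℚ := fun d =>
  ∑ᶠ a : Fin I.length ↪o ℕ,
    MvPowerSeries.coeff d (∏ k, (MvPowerSeries.X (a k) : MvPowerSeries ℕ ℚ) ^ (I.get k : ℕ))

/-- The space of quasi-symmetric functions, spanned by the `M_I`. -/
def QSym : Submodule ℚ (MvPowerSeries ℕ ℚ) :=
  Submodule.span ℚ (Set.range monomialQSym)

/-- The exponent of the monomial `x_1^{i_1} ⋯ x_r^{i_r}`. -/
def packed {n : ℕ} (g : Fin n → ℕ+) : ℕ →₀ ℕ := ∑ k : Fin n, Finsupp.single k.val (g k : ℕ)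

theorem support_sum_single {n : ℕ} (f : Fin n → ℕ+) (a : Fin n ↪o ℕ) :
    ((∑ k, Finsupp.single (a k) (f k : ℕ) : ℕ →₀ ℕ).support : Set ℕ) = Set.range a := by
  classical
  ext i
  simp only [Finset.mem_coe, Finsupp.mem_support_iff, Finsupp.finsetSum_apply,
    Finsupp.single_apply, Set.mem_range, ne_eq, Finset.sum_eq_zero_iff, not_forall]
  constructor
  · rintro ⟨k, _, hk⟩
    by_contra h
    exact hk (if_neg fun h' => h ⟨k, h'⟩)
  · rintro ⟨k, rfl⟩
    exact ⟨k, Finset.mem_univ _, by simp⟩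

theorem sum_single_apply {n : ℕ} (f : Fin n → ℕ+) (a : Fin n ↪o ℕ) (k : Fin n) :
    (∑ k, Finsupp.single (a k) (f k : ℕ) : ℕ →₀ ℕ) (a k) = f k := by
  classical
  simp [Finsupp.finsetSum_apply, Finsupp.single_apply]

theorem eq_of_sum_single_eq_packed {n m : ℕ} (f : Fin n → ℕ+) (g : Fin m → ℕ+) (a : Fin n ↪o ℕ)
    (h : (∑ k, Finsupp.single (a k) (f k : ℕ) : ℕ →₀ ℕ) = packed g) :
    List.ofFn f = List.ofFn g ∧ ∀ k, a k = (k : ℕ) := by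
  classical
  have hg : packed g = ∑ k, Finsupp.single (Fin.valOrderEmb m k) (g k : ℕ) := rfl
  have hr : Set.range a = Set.range (Fin.valOrderEmb m) := by
    rw [← support_sum_single f a, h, hg, support_sum_single]
  have hnm : n = m := by
    have h1 := Set.ncard_range_of_injective a.injective
    have h2 := Set.ncard_range_of_injective (Fin.valOrderEmb m).injective
    rw [hr, h2] at h1
    simpa using h1.symm
  subst hnm
  have ha : ∀ k, a k = (k : ℕ) := by
    have := (StrictMono.range_inj a.strictMono (Fin.valOrderEmb n).strictMono).1 hr
    intro k
    exact congrFun this k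
  refine ⟨?_, ha⟩
  congr 1
  funext k
  have h1 := sum_single_apply f a k
  have h2 := sum_single_apply g (Fin.valOrderEmb n) k
  rw [h, hg, ha k] at h1
  exact PNat.coe_injective (h1.symm.trans h2)

theorem coeff_monomialQSym_packed (I J : Comp) :
    MvPowerSeries.coeff (packed I.get) (monomialQSym J) = if J = I then 1 else 0 := by
  classical
  have key : ∀ (d : ℕ →₀ ℕ) (a : Fin J.length ↪o ℕ),
      MvPowerSeries.coeff d (∏ k, (MvPowerSeries.X (a k) : MvPowerSeries ℕ ℚ) ^ (J.get k : ℕ))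
        = if d = ∑ k, Finsupp.single (a k) (J.get k : ℕ) then 1 else 0 := by
    intro d a
    have : (∏ k, (MvPowerSeries.X (a k) : MvPowerSeries ℕ ℚ) ^ (J.get k : ℕ))
        = MvPowerSeries.monomial (∑ k, Finsupp.single (a k) (J.get k : ℕ)) 1 := by
      simp only [MvPowerSeries.X_pow_eq, MvPowerSeries.prod_monomial, Finset.prod_const_one]
    rw [this, MvPowerSeries.coeff_monomial]
  change (∑ᶠ a : Fin J.length ↪o ℕ, MvPowerSeries.coeff (packed I.get) _) = _
  simp only [key]
  split_ifs with h
  · subst h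
    rw [finsum_eq_single _ (Fin.valOrderEmb J.length)]
    · exact if_pos rfl
    · intro a ha
      refine if_neg fun h => ha ?_
      ext k
      exact (eq_of_sum_single_eq_packed _ _ a h.symm).2 k
  · rw [finsum_eq_zero_of_forall_eq_zero]
    intro a
    refine if_neg fun h' => h ?_
    simpa using (eq_of_sum_single_eq_packed _ _ a h'.symm).1

theorem linearIndependent_monomialQSym : LinearIndependent ℚ monomialQSym := by
  classical
  rw [linearIndependent_iff]
  intro c hc
  ext I
  have := congrArg (MvPowerSeries.coeff (packed I.get)) hc
  simpa [Finsupp.linearCombination_apply, Finsupp.sum, coeff_monomialQSym_packed] using this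

/-- The basis `(M_I)` of the space of quasi-symmetric functions. -/
def monomialBasis : Module.Basis Comp ℚ QSym :=
  Module.Basis.span linearIndependent_monomialQSym

/-! ### Virtual alphabets -/

/-- The algebra `Sym` of noncommutative symmetric functions over `R`: the free associative algebra
on generators `S_1, S_2, …`; its basis elements are the words `S^I = S_{i_1} ⋯ S_{i_r}`. -/
abbrev NSym (R : Type*) [CommRing R] : Type _ := MonoidAlgebra R (FreeMonoid ℕ+)

/-- The complete function `S_n`, with `S_0 = 1`. -/
def complete (R : Type*) [CommRing R] (n : ℕ) : NSym R :=
  if h : 0 < n then MonoidAlgebra.of R (FreeMonoid ℕ+) (FreeMonoid.of ⟨n, h⟩) else 1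

/-- The series `σ_x(A) = ∑_n S_n(A) x^n`. The formal variable of the power series records
the degree in `A`, so that infinite sums of elements of `Sym` make sense. -/
def sigma {R : Type*} [CommRing R] (x : R) : PowerSeries (NSym R) :=
  PowerSeries.mk fun n => x ^ n • complete R n

/-- The series `σ_x(A)^{-1}` (the constant term of `σ_x(A)` is `1`). -/
def sigmaInv {R : Type*} [CommRing R] (x : R) : PowerSeries (NSym R) :=
  PowerSeries.invOfUnit (sigma x) 1

/-- The ordered product `σ_{x_1}(A)^{-1} σ_{x_2}(A) σ_{x_3}(A)^{-1} ⋯ σ_{x_n}(A)^{(-1)^n}`. -/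
def virtualProduct {R : Type*} [CommRing R] (n : ℕ) (x : ℕ → R) : PowerSeries (NSym R) :=
  ((List.range' 1 n).map fun i => if Even i then sigma (x i) else sigmaInv (x i)).prod

/-- `M_I(⊖(x_1) ⊕ (x_2) ⊖ (x_3) ⋯ (x_n))`: the coefficient of `S^I` in
`∏_{1 ≤ i ≤ n} σ_{x_i}(A)^{(-1)^i}` (it lies in degree `i_1 + ⋯ + i_r`). -/
def monomialVirtual {R : Type*} [CommRing R] (n : ℕ) (x : ℕ → R) (I : Comp) : R :=
  (PowerSeries.coeff (I.map fun i : ℕ+ => (i : ℕ)).sum (virtualProduct n x)).coeff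
    (FreeMonoid.ofList I)

/-- `F ↦ F(⊖(x_1) ⊕ (x_2) ⊖ (x_3) ⋯ (x_n))` on quasi-symmetric functions, by linear extension
from the `M_I`. -/
def evalVirtual {R : Type*} [CommRing R] [Algebra ℚ R] (n : ℕ) (x : ℕ → R) : QSym →ₗ[ℚ] R :=
  monomialBasis.constr ℚ (monomialVirtual n x)

/-! ### The two alphabets -/

/-- Polynomials in `p_1, …, p_{m+1}, q_1, …, q_m`: the variable `Sum.inl k` is `p_{k+1}` and
`Sum.inr k` is `q_{k+1}`. -/
abbrev PQPoly (m : ℕ) : Type := MvPolynomial (Fin (m + 1) ⊕ Fin m) ℚ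

/-- The linear forms `x_{2i+1} = q_{i+1} + ⋯ + q_m + p_{i+1} + ⋯ + p_{m+1}` and
`x_{2i} = q_i + ⋯ + q_m + p_{i+1} + ⋯ + p_{m+1}` (used for the indices `1, …, 2m+1`). -/
def xForm (m j : ℕ) : PQPoly m :=
  let i := j / 2
  if Odd j then
    (∑ k : Fin m with i + 1 ≤ k.val + 1, MvPolynomial.X (Sum.inr k)) +
      ∑ k : Fin (m + 1) with i + 1 ≤ k.val + 1, MvPolynomial.X (Sum.inl k)
  else
    (∑ k : Fin m with i ≤ k.val + 1, MvPolynomial.X (Sum.inr k)) +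
      ∑ k : Fin (m + 1) with i + 1 ≤ k.val + 1, MvPolynomial.X (Sum.inl k)

/-- `F(𝕏_m)`, where `𝕏_m = ⊖(x_1) ⊕ (x_2) ⊖ (x_3) ⋯ ⊖(x_{2m+1})`. -/
def evalX (m : ℕ) : QSym →ₗ[ℚ] PQPoly m :=
  evalVirtual (2 * m + 1) (xForm m)

/-- The specialization `(p_1, …, p_m, p_{m+1}, 0, … ; q_1, …, q_m, 0, 0, …)` of a series in the two
infinite alphabets `p` (`Sum.inl`) and `q` (`Sum.inr`): all other variables are set to `0`. -/
def specialize (m : ℕ) (G : MvPowerSeries (ℕ ⊕ ℕ) ℚ) :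
    MvPowerSeries (Fin (m + 1) ⊕ Fin m) ℚ :=
  MvPowerSeries.killCompl (Fin.valEmbedding.sumMap Fin.valEmbedding) G

/-! ### Generating series of a ranked poset

A finite ranked poset is a finite partial order `P` with `[GradeMinOrder ℕ P]`: the height
`grade ℕ v` increases by exactly one along each covering relation and is `0` at the minimal
elements. -/

section Poset

variable (P : Type*) [PartialOrder P] [Fintype P] [GradeMinOrder ℕ P]

/-- The order condition on `r : P → {1, 2, …}`. -/
def OrderCondition (r : P → ℕ) : Prop :=
  Monotone r ∧ ∀ x y : P, x < y → Odd (grade ℕ x) → r x < r y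

/-- The number `|V_0|` of elements of even height. -/
def cardEven : ℕ := Nat.card {v : P // Even (grade ℕ v)}

/-- `F_P = ∑_r ∏_{v} x_{r(v)}`, over the `r` satisfying the order condition, given coefficient by
coefficient (for each monomial `d`, finitely many terms are non-zero). -/
def seriesF : MvPowerSeries ℕ ℚ := fun d =>
  ∑ᶠ r : {r : P → ℕ // OrderCondition P r},
    MvPowerSeries.coeff d (∏ v, (MvPowerSeries.X (r.1 v) : MvPowerSeries ℕ ℚ))

/-- `N_P = ∑_r ∏_{v ∈ V_0} p_{r(v)} ∏_{v ∈ V_1} q_{r(v)}`, over the `r` satisfying the order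
condition, where `V_0` and `V_1` are the sets of elements of even and of odd height. -/
def seriesN : MvPowerSeries (ℕ ⊕ ℕ) ℚ := fun d =>
  ∑ᶠ r : {r : P → ℕ // OrderCondition P r},
    MvPowerSeries.coeff d
      ((∏ v : P with Even (grade ℕ v),
          (MvPowerSeries.X (Sum.inl (r.1 v)) : MvPowerSeries (ℕ ⊕ ℕ) ℚ)) *
        ∏ v : P with Odd (grade ℕ v),
          (MvPowerSeries.X (Sum.inr (r.1 v)) : MvPowerSeries (ℕ ⊕ ℕ) ℚ))

end Poset

end SuperQSym

end

/-!
Number the letters `p_1, q_1, p_2, q_2, …, p_{m+1}` as `y_0, y_1, …, y_{2m}`, so that the arguments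
of `𝕏_m` are the tail sums `x_{j+1} = y_j + ⋯ + y_{2m}`. The proof compares two sums over maps from
`P` to `{0, …, 2m}`.

*The value of `F_P` at a virtual alphabet.* The algebra `Sym` is represented in the incidence
algebra of the lattice of lower sets of `P`, sending `S_n` to the indicator of the pairs `D ≤ E`
for which `E \ D` has `n` elements, none of odd height below another (`chainHom`). Counting chains
of lower sets, `F_P = ∑_I (S^I)(∅, P) M_I` (`seriesF_eq_sum`), so `F_P(𝕏_m)` is the entry `(∅, P)`
of the product that represents `σ_{x_1}⁻¹ σ_{x_2} ⋯`. The matrix of `σ_x⁻¹` is explicit: it is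
`(-x)^{|E \ D|}` if no element of even height in `E \ D` lies below another one, and `0` otherwise
(`weakLayer_mul_strictLayer`, a sign-reversing involution). Hence `F_P(𝕏_m)` is the sum of `∏_v
(-1)^{t(v)+1} x_{t(v)+1}` over the monotone maps `t` with `t(a) < t(b)` whenever `a < b` and `t(a)
+ h(a)` is even (`evalVirtual_seriesF`).

*Cancellation.* Expanding each `x` into `y`'s gives a sum over pairs `t ≤ u` with weight `∏_v
y_{u(v)}`. For fixed `u` the signed number of `t`'s is `(-1)^|V_0|` if `u` is monotone with `u ≡ h`
modulo 2, and `0` otherwise (`signed_sum`): at a maximal element `v` the value `t(v)` runs through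
an interval whose lower end has the parity of `h(v)`, so the alternating sum over `t(v)` is `±1` or
`0`, and one concludes by induction on `P`.

*Comparison.* The surviving maps `u` are exactly `u = 2r + (h mod 2)` with `r` satisfying the order
condition (`isAlternating_iff`), and `∏_v y_{u(v)}` is the monomial of `r` in `N_P`.

A series is determined by its specializations because each monomial involves finitely many
variables. Finally `F_P` determines the sign `(-1)^|V_0|`, since the specializations of `N_P` take
positive values when all variables are set to `1` and `m` is large (`neg_one_pow_cardEven_eq`).
-/

noncomputable section

namespace SuperQSym

open Finset
open scoped Classical

/-! ### The incidence algebra of the lattice of lower sets -/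

section Layers

variable {P : Type*} [PartialOrder P] {R : Type*} [CommRing R]

/-- Membership in the incidence algebra of the lattice of lower sets. -/
def IsIncidence (B : Matrix (LowerSet P) (LowerSet P) R) : Prop :=
  ∀ D E, ¬ D ≤ E → B D E = 0

theorem isIncidence_one : IsIncidence (1 : Matrix (LowerSet P) (LowerSet P) R) :=
  fun _ _ h => Matrix.one_apply_ne fun h' => h h'.le

variable [Fintype P]

instance : Fintype (LowerSet P) :=
  haveI : Finite (LowerSet P) := Finite.of_injective (fun D : LowerSet P => (D : Set P))
    SetLike.coe_injective
  Fintype.ofFinite _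

/-- The set difference `E \ D` of two lower sets, as a finset. -/
def gap (D E : LowerSet P) : Finset P := {x | x ∈ E ∧ x ∉ D}

@[simp] theorem mem_gap {D E : LowerSet P} {x : P} : x ∈ gap D E ↔ x ∈ E ∧ x ∉ D := by
  simp [gap]

theorem card_gap_add {D G E : LowerSet P} (h1 : D ≤ G) (h2 : G ≤ E) :
    #(gap D E) = #(gap D G) + #(gap G E) := by
  rw [← card_union_of_disjoint]
  · congr 1
    ext x
    have := @h1 x
    have := @h2 x
    simp only [mem_union, mem_gap]
    tauto
  · rw [disjoint_left]
    intro x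
    simp only [mem_gap]
    tauto

theorem gap_eq_empty_iff {D E : LowerSet P} (h : D ≤ E) : gap D E = ∅ ↔ D = E := by
  constructor
  · intro h'
    refine le_antisymm h fun x hx => ?_
    by_contra hxD
    have : x ∈ gap D E := mem_gap.2 ⟨hx, hxD⟩
    simp [h'] at this
  · rintro rfl
    ext x
    simp

/-- The matrix with entry `w (E \ D)` at a pair `D ≤ E` of lower sets of `P`, and `0` elsewhere:
an element of the incidence algebra of the lattice of lower sets. -/
def layer (w : Finset P → R) : Matrix (LowerSet P) (LowerSet P) R :=
  .of fun D E => if D ≤ E then w (gap D E) else 0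

theorem isIncidence_layer (w : Finset P → R) : IsIncidence (layer w) :=
  fun _ _ h => if_neg h

theorem IsIncidence.mul {B C : Matrix (LowerSet P) (LowerSet P) R} (hB : IsIncidence B)
    (hC : IsIncidence C) : IsIncidence (B * C) := by
  intro D E h
  rw [Matrix.mul_apply]
  refine sum_eq_zero fun G _ => ?_
  by_cases h1 : D ≤ G
  · rw [hC G E fun h2 => h (h1.trans h2), mul_zero]
  · rw [hB D G h1, zero_mul]

/-- The matrix `B`, each entry `(D, E)` being placed in degree `|E \ D|`. -/
def graded (B : Matrix (LowerSet P) (LowerSet P) R) :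
    PowerSeries (Matrix (LowerSet P) (LowerSet P) R) :=
  PowerSeries.mk fun n => .of fun D E => if #(gap D E) = n then B D E else 0

theorem graded_one : graded (1 : Matrix (LowerSet P) (LowerSet P) R) = 1 := by
  ext n D E
  rw [graded, PowerSeries.coeff_mk, PowerSeries.coeff_one, Matrix.of_apply]
  by_cases hDE : D = E
  · subst hDE
    rw [(gap_eq_empty_iff le_rfl).2 rfl, card_empty]
    rcases eq_or_ne n 0 with rfl | hn
    · simp
    · simp [hn, hn.symm]
  · rw [Matrix.one_apply_ne hDE]
    split_ifs <;> simp [hDE]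

theorem graded_mul {B C : Matrix (LowerSet P) (LowerSet P) R} (hB : IsIncidence B)
    (hC : IsIncidence C) : graded (B * C) = graded B * graded C := by
  ext n D E
  simp only [graded, PowerSeries.coeff_mul, PowerSeries.coeff_mk, Matrix.of_apply,
    Matrix.sum_apply, Matrix.mul_apply]
  rw [sum_comm]
  have key : ∀ G, (∑ p ∈ antidiagonal n, (if #(gap D G) = p.1 then B D G else 0) *
      (if #(gap G E) = p.2 then C G E else 0)) =
        if #(gap D E) = n then B D G * C G E else 0 := by
    intro G
    by_cases h1 : D ≤ G
    · by_cases h2 : G ≤ E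
      · rw [card_gap_add h1 h2]
        split_ifs with h
        · rw [sum_eq_single (#(gap D G), #(gap G E))]
          · simp
          · rintro ⟨a, b⟩ _ hne
            rw [ite_zero_mul_ite_zero, if_neg]
            rintro ⟨rfl, rfl⟩
            exact hne rfl
          · intro h'
            exact absurd (mem_antidiagonal.2 h) h'
        · refine sum_eq_zero ?_
          rintro ⟨a, b⟩ hab
          rw [ite_zero_mul_ite_zero, if_neg]
          rintro ⟨rfl, rfl⟩
          exact h (mem_antidiagonal.1 hab)
      · simp [hC G E h2]
    · simp [hB D G h1]
  rw [sum_congr rfl fun G _ => key G]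
  split_ifs <;> simp

theorem coeff_graded_gap (B : Matrix (LowerSet P) (LowerSet P) R) (D E : LowerSet P) :
    PowerSeries.coeff #(gap D E) (graded B) D E = B D E := by
  simp [graded]

theorem isIncidence_list_prod {ι : Type*} (l : List ι)
    (B : ι → Matrix (LowerSet P) (LowerSet P) R) (hB : ∀ i, IsIncidence (B i)) :
    IsIncidence (l.map B).prod := by
  induction l with
  | nil => exact isIncidence_one
  | cons i l ih => simpa using (hB i).mul ih

theorem graded_list_prod {ι : Type*} (l : List ι)
    (B : ι → Matrix (LowerSet P) (LowerSet P) R) (hB : ∀ i, IsIncidence (B i)) :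
    graded (l.map B).prod = (l.map fun i => graded (B i)).prod := by
  induction l with
  | nil => exact graded_one
  | cons i l ih =>
    rw [List.map_cons, List.prod_cons, graded_mul (hB i) (isIncidence_list_prod l B hB), ih,
      List.map_cons, List.prod_cons]

/-- Transfer-matrix formula: a product of `n` layers, read off between `∅` and `E`, is a sum over
the chains `∅ = D_0 ≤ ⋯ ≤ D_n = E`. Such a chain is encoded by the monotone map `t` which is `j`
on `D_{j+1} \ D_j` and `n` outside `E`. -/
theorem prod_layer_bot_apply (w : ℕ → Finset P → R) (n : ℕ) (E : LowerSet P) :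
    ((List.range n).map fun j => layer (w j)).prod ⊥ E =
      ∑ t ∈ Fintype.piFinset fun _ : P => range (n + 1) with
        Monotone t ∧ ∀ v, t v < n ↔ v ∈ E, ∏ j ∈ range n, w j {v | t v = j} := by
  induction n generalizing E with
  | zero =>
    by_cases hE : E = ⊥
    · subst hE
      rw [sum_eq_single_of_mem (fun _ => 0)]
      · simp
      · simp [monotone_const]
      · intro t ht hne
        simp only [mem_filter, Fintype.mem_piFinset, mem_range] at ht
        exact absurd (funext fun v => by have := ht.1 v; omega) hne
    · rw [filter_false_of_mem, sum_empty]
      · simp [Ne.symm hE]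
      · rintro t - ⟨-, ht⟩
        refine hE (le_bot_iff.1 fun v hv => ?_)
        have := (ht v).2 hv
        omega
  | succ n ih =>
    rw [List.range_succ, List.map_append, List.prod_append, Matrix.mul_apply]
    simp only [List.map_cons, List.map_nil, List.prod_cons, List.prod_nil, mul_one, ih, sum_mul]
    rw [sum_sigma']
    simp only [layer, Matrix.of_apply, mul_ite, mul_zero]
    rw [← sum_filter]
    refine sum_bij' (fun s _ v => if v ∈ E then s.2 v else n + 1)
      (fun t ht => ⟨⟨{v | t v < n}, fun a b hab ha =>
        ((mem_filter.1 ht).2.1 hab).trans_lt ha⟩, fun v => min (t v) n⟩) ?_ ?_ ?_ ?_ ?_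
    · rintro ⟨D, t⟩ h
      simp only [mem_filter, mem_sigma, mem_univ, Fintype.mem_piFinset, mem_range, true_and] at h ⊢
      obtain ⟨⟨h1, h2, h3⟩, h4⟩ := h
      refine ⟨fun v => ?_, fun a b hab => ?_, fun v => ?_⟩
      · have := h1 v
        split_ifs <;> omega
      · have ha := h1 a
        have := h2 hab
        have := @LowerSet.lower _ _ E b a hab
        by_cases hb : b ∈ E
        · simp only [if_pos hb, if_pos (show a ∈ E from this hb)]
          exact h2 hab
        · simp only [if_neg hb]
          split_ifs <;> omega
      · have := h1 v
        split_ifs with hv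
        · simp [hv]; omega
        · simp [hv]
    · intro t ht
      simp only [mem_filter, mem_sigma, mem_univ, Fintype.mem_piFinset, mem_range, true_and] at ht ⊢
      obtain ⟨h1, h2, h3⟩ := ht
      refine ⟨⟨fun v => by omega, fun a b hab => min_le_min_right _ (h2 hab), fun v => ?_⟩,
        fun v hv => ?_⟩
      · change _ ↔ t v < n
        omega
      · have hv : t v < n := hv
        exact (h3 v).1 (by omega)
    · rintro ⟨D, t⟩ h
      simp only [mem_filter, mem_sigma, mem_univ, Fintype.mem_piFinset, mem_range, true_and] at h ⊢
      obtain ⟨⟨h1, h2, h3⟩, h4⟩ := h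
      have h4' : ∀ v, v ∉ E → ¬ t v < n := fun v hv hlt => hv (h4 ((h3 v).1 hlt))
      congr 1
      · ext v
        change (if v ∈ E then t v else n + 1) < n ↔ v ∈ D
        rw [← h3]
        split_ifs with hv
        · rfl
        · have := h4' v hv
          omega
      · funext v
        have := h1 v
        split_ifs with hv
        · omega
        · have := h4' v hv
          omega
    · intro t ht
      simp only [mem_filter, Fintype.mem_piFinset, mem_range] at ht
      obtain ⟨h1, h2, h3⟩ := ht
      funext v
      have := h1 v
      have := h3 v
      change (if v ∈ E then min (t v) n else n + 1) = t v
      split_ifs with hv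
      · simp only [hv, iff_true] at this; omega
      · simp only [hv, iff_false] at this; omega
    · rintro ⟨D, t⟩ h
      simp only [mem_filter, mem_sigma, mem_univ, Fintype.mem_piFinset, mem_range, true_and] at h ⊢
      obtain ⟨⟨h1, h2, h3⟩, h4⟩ := h
      have h4' : ∀ v, v ∉ E → ¬ t v < n := fun v hv hlt => hv (h4 ((h3 v).1 hlt))
      rw [prod_range_succ]
      congr 1
      · refine prod_congr rfl fun j hj => ?_
        rw [mem_range] at hj
        congr 1
        ext v
        simp only [mem_filter, mem_univ, true_and]
        split_ifs with hv
        · rfl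
        · have := h4' v hv
          omega
      · congr 1
        ext v
        simp only [mem_filter, mem_univ, true_and, mem_gap, ← h3]
        have := h1 v
        split_ifs with hv
        · simp [hv]; omega
        · simp [hv]

theorem prod_layer_bot_top (w : ℕ → Finset P → R) (n : ℕ) :
    ((List.range n).map fun j => layer (w j)).prod ⊥ ⊤ =
      ∑ t ∈ Fintype.piFinset fun _ : P => range n with Monotone t,
        ∏ j ∈ range n, w j {v | t v = j} := by
  rw [prod_layer_bot_apply]
  refine sum_congr ?_ fun _ _ => rfl
  ext t
  simp only [mem_filter, Fintype.mem_piFinset, mem_range, LowerSet.mem_top, iff_true]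
  constructor
  · rintro ⟨-, h1, h2⟩
    exact ⟨h2, h1⟩
  · rintro ⟨h2, h1⟩
    exact ⟨fun v => (h2 v).trans (Nat.lt_succ_self n), h1, h2⟩

end Layers

/-! ### Representing noncommutative symmetric functions by chains of lower sets -/

section Virtual

variable {P : Type*} [PartialOrder P] (h : P → ℕ)

/-- In the order condition, `S` can be a fibre of `r`: no element of odd height lies below another
element of `S`. -/
def WeakOn (S : Finset P) : Prop := ∀ x ∈ S, ∀ y ∈ S, x < y → Even (h x)

/-- The opposite condition: no element of even height lies below another element of `S`. -/
def StrictOn (S : Finset P) : Prop := ∀ x ∈ S, ∀ y ∈ S, x < y → Odd (h x)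

variable {h}

theorem WeakOn.mono {S T : Finset P} (hT : WeakOn h T) (hS : S ⊆ T) : WeakOn h S :=
  fun x hx y hy => hT x (hS hx) y (hS hy)

theorem StrictOn.mono {S T : Finset P} (hT : StrictOn h T) (hS : S ⊆ T) : StrictOn h S :=
  fun x hx y hy => hT x (hS hx) y (hS hy)

/-- In a nonempty finset there is an element `v` which can be moved between a lower part without
odd-below pairs and an upper part without even-below pairs: a minimal element of odd height, or any
maximal element if all heights are even. -/
theorem exists_pivot (h : P → ℕ) {S : Finset P} (hS : S.Nonempty) :
    ∃ v ∈ S, (∀ x ∈ S, x < v → Even (h x)) ∧ ((∃ y ∈ S, v < y) → Odd (h v)) := by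
  by_cases ho : ({x ∈ S | Odd (h x)}).Nonempty
  · obtain ⟨v, hv⟩ := ({x ∈ S | Odd (h x)}).exists_minimal ho
    have hvm := mem_filter.1 hv.1
    refine ⟨v, hvm.1, fun x hx hxv => ?_, fun _ => hvm.2⟩
    by_contra hodd
    exact hxv.not_ge (hv.2 (mem_filter.2 ⟨hx, Nat.not_even_iff_odd.1 hodd⟩) hxv.le)
  · obtain ⟨v, hv⟩ := S.exists_maximal hS
    refine ⟨v, hv.1, fun x hx _ => ?_, ?_⟩
    · by_contra hodd
      exact ho ⟨x, mem_filter.2 ⟨hx, Nat.not_even_iff_odd.1 hodd⟩⟩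
    · rintro ⟨y, hy, hvy⟩
      exact absurd (hv.2 hy hvy.le) hvy.not_ge

variable [Fintype P] {R : Type*} [CommRing R]

variable (h) in
/-- The matrix that represents `σ_x`. -/
def weakLayer (x : R) : Matrix (LowerSet P) (LowerSet P) R :=
  layer fun S => if WeakOn h S then x ^ #S else 0

variable (h) in
/-- The matrix that represents `σ_x⁻¹`. -/
def strictLayer (x : R) : Matrix (LowerSet P) (LowerSet P) R :=
  layer fun S => if StrictOn h S then (-x) ^ #S else 0

/-- Adding a pivot `v` of `E \ D` to `G`, or removing it from `G`, yields a lower set. -/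
theorem exists_toggle {D E : LowerSet P} {v : P} (hv : v ∈ gap D E)
    (hbelow : ∀ x ∈ gap D E, x < v → Even (h x)) (habove : (∃ y ∈ gap D E, v < y) → Odd (h v))
    {G : LowerSet P} (h1 : D ≤ G) (h2 : G ≤ E) (hw : WeakOn h (gap D G))
    (hs : StrictOn h (gap G E)) :
    ∃ G' : LowerSet P, (∀ x, x ∈ G' ↔ if x = v then v ∉ G else x ∈ G) ∧ D ≤ G' ∧ G' ≤ E ∧
      WeakOn h (gap D G') ∧ StrictOn h (gap G' E) := by
  obtain ⟨hvE, hvD⟩ := mem_gap.1 hv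
  by_cases hvG : v ∈ G
  · have hmax : ∀ y ∈ G, ¬ v < y := by
      intro y hy hvy
      have hyD : y ∉ D := fun h' => hvD (D.lower hvy.le h')
      have h3 := habove ⟨y, mem_gap.2 ⟨h2 hy, hyD⟩, hvy⟩
      have h4 := hw v (mem_gap.2 ⟨hvG, hvD⟩) y (mem_gap.2 ⟨hy, hyD⟩) hvy
      exact Nat.not_even_iff_odd.2 h3 h4
    refine ⟨⟨{x | x ∈ G ∧ x ≠ v}, ?_⟩, ?_, ?_, ?_, ?_, ?_⟩
    · rintro a b hba ⟨ha, hav⟩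
      refine ⟨G.lower hba ha, ?_⟩
      rintro rfl
      exact hmax a ha (lt_of_le_of_ne hba (Ne.symm hav))
    · intro x
      change x ∈ G ∧ x ≠ v ↔ _
      split_ifs with hx <;> simp [hx, hvG]
    · exact fun x hx => ⟨h1 hx, fun h' => hvD (h' ▸ hx)⟩
    · exact fun x hx => h2 hx.1
    · refine hw.mono fun x hx => ?_
      obtain ⟨hx1, hx2⟩ := mem_gap.1 hx
      exact mem_gap.2 ⟨hx1.1, hx2⟩
    · intro x hx y hy hxy
      obtain ⟨hxE, hx⟩ := mem_gap.1 hx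
      obtain ⟨hyE, hy⟩ := mem_gap.1 hy
      have hx : x ∈ G → x = v := fun h' => by_contra fun h'' => hx ⟨h', h''⟩
      have hy : y ∈ G → y = v := fun h' => by_contra fun h'' => hy ⟨h', h''⟩
      have hyG : y ∉ G := by
        intro h'
        have h3 := hx (G.lower hxy.le h')
        have h4 := hy h'
        rw [h3, h4] at hxy
        exact lt_irrefl _ hxy
      by_cases hxG : x ∈ G
      · obtain rfl := hx hxG
        exact habove ⟨y, mem_gap.2 ⟨hyE, fun h' => hyG (h1 h')⟩, hxy⟩
      · exact hs x (mem_gap.2 ⟨hxE, hxG⟩) y (mem_gap.2 ⟨hyE, hyG⟩) hxy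
  · have hmin : ∀ x, x < v → x ∈ G := by
      intro x hxv
      by_contra hxG
      have hxE := E.lower hxv.le hvE
      have h3 := hbelow x (mem_gap.2 ⟨hxE, fun h' => hxG (h1 h')⟩) hxv
      have h4 := hs x (mem_gap.2 ⟨hxE, hxG⟩) v (mem_gap.2 ⟨hvE, hvG⟩) hxv
      exact Nat.not_even_iff_odd.2 h4 h3
    refine ⟨⟨{x | x ∈ G ∨ x = v}, ?_⟩, ?_, ?_, ?_, ?_, ?_⟩
    · rintro a b hba (ha | rfl)
      · exact Or.inl (G.lower hba ha)
      · rcases hba.lt_or_eq with hlt | rfl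
        · exact Or.inl (hmin b hlt)
        · exact Or.inr rfl
    · intro x
      change x ∈ G ∨ x = v ↔ _
      split_ifs with hx <;> simp [hx, hvG]
    · exact fun x hx => Or.inl (h1 hx)
    · rintro x (hx | rfl)
      · exact h2 hx
      · exact hvE
    · intro x hx y hy hxy
      obtain ⟨hx', hxD⟩ := mem_gap.1 hx
      obtain ⟨hy', hyD⟩ := mem_gap.1 hy
      rcases hy' with hyG | rfl
      · rcases hx' with hxG | rfl
        · exact hw x (mem_gap.2 ⟨hxG, hxD⟩) y (mem_gap.2 ⟨hyG, hyD⟩) hxy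
        · exact absurd (G.lower hxy.le hyG) hvG
      · have hx : x ∈ E := E.lower hxy.le hvE
        exact hbelow x (mem_gap.2 ⟨hx, hxD⟩) hxy
    · refine hs.mono fun x hx => ?_
      obtain ⟨hx1, hx2⟩ := mem_gap.1 hx
      exact mem_gap.2 ⟨hx1, fun h' => hx2 (Or.inl h')⟩

variable (h) in
/-- `σ_x σ_x⁻¹ = 1` for the representing matrices: this is the formula for the antipode of the
quasi-symmetric function of a poset, proved by moving a pivot between the two parts. -/
theorem weakLayer_mul_strictLayer (x : R) : weakLayer h x * strictLayer h x = 1 := by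
  ext D E
  by_cases hDE : D ≤ E
  swap
  · rw [isIncidence_one D E hDE]
    exact (isIncidence_layer _).mul (isIncidence_layer _) D E hDE
  rw [Matrix.mul_apply]
  have hterm : ∀ G, weakLayer h x D G * strictLayer h x G E =
      if D ≤ G ∧ G ≤ E ∧ WeakOn h (gap D G) ∧ StrictOn h (gap G E) then
        (-1) ^ #(gap G E) * x ^ #(gap D E) else 0 := by
    intro G
    simp only [weakLayer, strictLayer, layer, Matrix.of_apply]
    by_cases h1 : D ≤ G <;> by_cases h2 : G ≤ E <;> by_cases h3 : WeakOn h (gap D G) <;>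
      by_cases h4 : StrictOn h (gap G E) <;> simp only [h1, h2, h3, h4, if_true, if_false,
        and_true, and_false, mul_zero, zero_mul]
    rw [card_gap_add h1 h2, neg_pow x]
    ring
  rw [sum_congr rfl fun G _ => hterm G, ← sum_filter]
  rcases eq_or_ne D E with rfl | hne
  · rw [sum_eq_single_of_mem D]
    · simp [(gap_eq_empty_iff (le_refl D)).2 rfl]
    · rw [mem_filter, (gap_eq_empty_iff (le_refl D)).2 rfl]
      simp [WeakOn, StrictOn]
    · intro G hG hne
      obtain ⟨-, h1, h2, -⟩ := mem_filter.1 hG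
      exact absurd (le_antisymm h2 h1) hne
  · rw [Matrix.one_apply_ne hne]
    have hS : (gap D E).Nonempty := by
      rw [nonempty_iff_ne_empty, Ne, gap_eq_empty_iff hDE]
      exact hne
    obtain ⟨v, hv, hbelow, habove⟩ := exists_pivot h hS
    have tog := fun G (hG : D ≤ G ∧ G ≤ E ∧ WeakOn h (gap D G) ∧ StrictOn h (gap G E)) =>
      exists_toggle hv hbelow habove hG.1 hG.2.1 hG.2.2.1 hG.2.2.2
    refine sum_involution (fun G hG => (tog G (mem_filter.1 hG).2).choose) ?_ ?_ ?_ ?_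
    · intro G hG
      obtain ⟨hm, h1', h2', -⟩ := (tog G (mem_filter.1 hG).2).choose_spec
      set G' := (tog G (mem_filter.1 hG).2).choose
      obtain ⟨-, h1, h2, -⟩ := mem_filter.1 hG
      have hvE := (mem_gap.1 hv).1
      by_cases hvG : v ∈ G
      · have : gap G' E = insert v (gap G E) := by
          ext y
          rw [mem_insert, mem_gap, mem_gap, hm]
          by_cases hy : y = v
          · simp [hy, hvE, hvG]
          · simp [hy]
        rw [this, card_insert_of_notMem (by simp [hvG])]
        ring
      · have : gap G E = insert v (gap G' E) := by
          ext y
          rw [mem_insert, mem_gap, mem_gap, hm]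
          by_cases hy : y = v
          · simp [hy, hvE, hvG]
          · simp [hy]
        rw [this, card_insert_of_notMem (by simp [hm, hvG])]
        ring
    · intro G hG _ heq
      obtain ⟨hm, -⟩ := (tog G (mem_filter.1 hG).2).choose_spec
      have := hm v
      rw [heq] at this
      simp at this
    · intro G hG
      exact mem_filter.2 ⟨mem_univ _, (tog G (mem_filter.1 hG).2).choose_spec.2⟩
    · intro G hG
      have hm := (tog G (mem_filter.1 hG).2).choose_spec.1
      have hG' := (tog G (mem_filter.1 hG).2).choose_spec.2
      have hm' := (tog _ hG').choose_spec.1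
      refine LowerSet.ext (Set.ext fun y => ?_)
      refine (hm' y).trans ?_
      rw [hm, hm]
      by_cases hy : y = v <;> simp [hy]

variable (R h) in
/-- The representation of `Sym` in the incidence algebra of the lattice of lower sets of `P` for
which `(S^I)(D, E)` counts the chains from `D` to `E` with steps of sizes `i_1, …, i_r` that can be
fibres of a map satisfying the order condition. -/
def chainHom : NSym R →ₐ[R] Matrix (LowerSet P) (LowerSet P) R :=
  MonoidAlgebra.lift R _ (FreeMonoid ℕ+) (FreeMonoid.lift fun n : ℕ+ =>
    layer fun S => if #S = (n : ℕ) ∧ WeakOn h S then 1 else 0)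

theorem chainHom_complete (n : ℕ) :
    chainHom h R (complete R n) = layer fun S => if #S = n ∧ WeakOn h S then 1 else 0 := by
  rw [complete]
  split_ifs with hn
  · rw [chainHom, MonoidAlgebra.lift_of]
    exact FreeMonoid.lift_eval_of _ _
  · obtain rfl : n = 0 := by omega
    rw [map_one]
    ext D E
    rw [layer, Matrix.of_apply]
    by_cases hDE : D ≤ E
    · rw [if_pos hDE]
      by_cases he : D = E
      · subst he
        simp [(gap_eq_empty_iff (le_refl D)).2 rfl, WeakOn]
      · rw [Matrix.one_apply_ne he, if_neg]
        rw [card_eq_zero, gap_eq_empty_iff hDE]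
        exact fun h' => he h'.1
    · rw [if_neg hDE, isIncidence_one D E hDE]

theorem map_chainHom_sigma (x : R) :
    PowerSeries.map (chainHom h R).toRingHom (sigma x) = graded (weakLayer h x) := by
  ext n D E
  rw [PowerSeries.coeff_map, sigma, PowerSeries.coeff_mk]
  change chainHom h R _ D E = _
  rw [map_smul,
    chainHom_complete, graded, PowerSeries.coeff_mk, weakLayer, layer, layer, Matrix.smul_apply,
    Matrix.of_apply, Matrix.of_apply, Matrix.of_apply]
  by_cases h1 : D ≤ E <;> by_cases h2 : #(gap D E) = n <;> by_cases h3 : WeakOn h (gap D E) <;>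
    simp [h1, h2, h3]

theorem map_chainHom_sigmaInv (x : R) :
    PowerSeries.map (chainHom h R).toRingHom (sigmaInv x) = graded (strictLayer h x) := by
  have h1 : sigmaInv x * sigma x = 1 :=
    MvPowerSeries.invOfUnit_mul (sigma x) 1 (by
      change PowerSeries.constantCoeff (sigma x) = 1
      rw [← PowerSeries.coeff_zero_eq_constantCoeff_apply]
      simp [sigma, complete])
  have h2 := congrArg (PowerSeries.map (chainHom h R).toRingHom) h1
  rw [map_mul, map_one, map_chainHom_sigma] at h2
  have h3 : graded (weakLayer h x) * graded (strictLayer h x) = 1 := by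
    rw [weakLayer, strictLayer, ← graded_mul (isIncidence_layer _) (isIncidence_layer _),
      ← weakLayer, ← strictLayer, weakLayer_mul_strictLayer,
      graded_one]
  exact left_inv_eq_right_inv h2 h3

variable (h) in
/-- The value of `∑_I (S^I)(∅, P) M_I` at a virtual alphabet, in the incidence algebra. -/
theorem chainHom_virtualProduct (n : ℕ) (x : ℕ → R) :
    chainHom h R (PowerSeries.coeff (Fintype.card P) (virtualProduct n x)) ⊥ ⊤ =
      ∑ t ∈ Fintype.piFinset fun _ : P => range n with
          Monotone t ∧ ∀ a b, a < b → Even (t a + h a) → t a < t b,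
        ∏ v, (-1) ^ (t v + 1) * x (t v + 1) := by
  have hmap : PowerSeries.map (chainHom h R).toRingHom (virtualProduct n x) =
      graded ((List.range n).map fun j => layer fun S =>
        if Even (j + 1) then (if WeakOn h S then x (j + 1) ^ #S else 0)
        else (if StrictOn h S then (-x (j + 1)) ^ #S else 0)).prod := by
    rw [virtualProduct, map_list_prod, List.map_map,
      graded_list_prod _ _ fun _ => isIncidence_layer _, List.range'_eq_map_range, List.map_map]
    congr 1
    refine List.map_congr_left fun j _ => ?_
    simp only [Function.comp_apply, add_comm 1 j]
    split_ifs with hj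
    · exact map_chainHom_sigma _
    · exact map_chainHom_sigmaInv _
  have hcard : Fintype.card P = #(gap (⊥ : LowerSet P) ⊤) := by
    rw [← card_univ]
    congr 1
    ext x
    simp
  have h1 : _ = chainHom h R (PowerSeries.coeff (Fintype.card P) (virtualProduct n x)) :=
    PowerSeries.coeff_map (chainHom h R).toRingHom (Fintype.card P) (virtualProduct n x)
  rw [hmap] at h1
  rw [← h1, hcard, coeff_graded_gap, prod_layer_bot_top]
  have h2 : ∀ t ∈ (Fintype.piFinset fun _ : P => range n), Monotone t →
      ∏ j ∈ range n, (if Even (j + 1) then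
        (if WeakOn h {v | t v = j} then x (j + 1) ^ #{v | t v = j} else 0)
        else (if StrictOn h {v | t v = j} then (-x (j + 1)) ^ #{v | t v = j} else 0)) =
      if ∀ a b, a < b → Even (t a + h a) → t a < t b then
        ∏ v, (-1) ^ (t v + 1) * x (t v + 1) else 0 := by
    intro t ht hmono
    split_ifs with hok
    · rw [← prod_fiberwise_of_maps_to (g := t) (t := range n)
        fun v _ => Fintype.mem_piFinset.1 ht v]
      refine prod_congr rfl fun j _ => ?_
      rw [prod_congr rfl (g := fun _ => (-1) ^ (j + 1) * x (j + 1)) fun v hv => by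
        rw [(mem_filter.1 hv).2], prod_const]
      split_ifs with hj hw hs
      · rw [hj.neg_one_pow, one_mul]
      · refine absurd (fun a ha b hb hab => ?_) hw
        have ha := (mem_filter.1 ha).2
        have hb := (mem_filter.1 hb).2
        by_contra hodd
        have := hok a b hab (by
          rw [Nat.not_even_iff_odd] at hodd
          rw [ha]
          have hj : Odd j := by rwa [Nat.even_add_one, Nat.not_even_iff_odd] at hj
          exact hj.add_odd hodd)
        omega
      · rw [(Nat.not_even_iff_odd.1 hj).neg_one_pow, neg_one_mul]
      · refine absurd (fun a ha b hb hab => ?_) hs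
        have ha := (mem_filter.1 ha).2
        have hb := (mem_filter.1 hb).2
        by_contra heven
        have := hok a b hab (by
          rw [Nat.not_odd_iff_even] at heven
          rw [ha]
          have hj : Even j := by rwa [Nat.even_add_one, not_not] at hj
          exact hj.add heven)
        omega
    · push Not at hok
      obtain ⟨a, b, hab, hev, hle⟩ := hok
      have heq : t b = t a := le_antisymm hle (hmono hab.le)
      refine prod_eq_zero (Fintype.mem_piFinset.1 ht a) ?_
      rw [Nat.even_add] at hev
      split_ifs with hj hw hs
      · have := hw a (by simp) b (by simp [heq]) hab
        rw [Nat.even_add_one] at hj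
        tauto
      · rfl
      · have := hs a (by simp) b (by simp [heq]) hab
        rw [← Nat.not_even_iff_odd] at this
        rw [Nat.even_add_one] at hj
        tauto
      · rfl
  rw [sum_congr rfl fun t ht => h2 t (mem_filter.1 ht).1 (mem_filter.1 ht).2, ← sum_filter,
    filter_filter]

end Virtual

/-! ### A signed count of maps below a given map -/

section SignedCount

theorem sum_neg_one_pow_Icc (L U : ℕ) :
    ∑ k ∈ range (U + 1) with L ≤ k, (-1 : ℤ) ^ k =
      if L ≤ U ∧ Even (U + L) then (-1) ^ L else 0 := by
  induction U with
  | zero =>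
    rcases Nat.eq_zero_or_pos L with rfl | hL
    · simp
    · rw [if_neg (by omega), filter_false_of_mem, sum_empty]
      simp [hL]
  | succ U ih =>
    rw [range_add_one, filter_insert]
    rcases lt_trichotomy L (U + 1) with hL | hL | hL
    · rw [if_pos hL.le, sum_insert (by simp), ih]
      have h1 : L ≤ U := by omega
      have h2 : L ≤ U + 1 := by omega
      have h3 : U + 1 + L = U + L + 1 := by omega
      simp only [h1, h2, true_and, h3, Nat.even_add_one]
      rcases Nat.even_or_odd (U + L) with he | ho
      · rw [if_pos he, if_neg (not_not.2 he), pow_succ, neg_one_pow_congr (Nat.even_add.1 he)]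
        ring
      · rw [← Nat.not_even_iff_odd] at ho
        rw [if_neg ho, if_pos ho, add_zero]
        refine neg_one_pow_congr ?_
        rw [Nat.even_add_one]
        rw [Nat.even_add] at ho
        tauto
    · subst hL
      rw [if_pos le_rfl, sum_insert (by simp), ih, if_neg (by omega), add_zero,
        if_pos ⟨le_rfl, ⟨_, rfl⟩⟩]
    · rw [if_neg (by omega), ih, if_neg (by omega), if_neg (by omega)]

/-- The lower bound that the value `t x = k` at an element `x` of height `m` imposes on the value at
the elements above `x`. -/
def nextBound (m k : ℕ) : ℕ := if Even (k + m) then k + 1 else k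

theorem nextBound_le_iff {m k l : ℕ} : nextBound m k ≤ l ↔ k ≤ l ∧ (Even (k + m) → k < l) := by
  unfold nextBound
  split_ifs with h
  · simp only [h, true_imp_iff]; omega
  · simp [h]

theorem le_nextBound (m k : ℕ) : k ≤ nextBound m k := (nextBound_le_iff.1 le_rfl).1

theorem odd_nextBound_add (m k : ℕ) : Odd (nextBound m k + m) := by
  unfold nextBound
  split_ifs with h
  · rw [add_right_comm]
    exact h.add_one
  · exact Nat.not_even_iff_odd.1 h

/-- The sum over the value `k` at a new largest element of height `m`, whose lower elements are
given by `b`. The largest of the bounds on `k` comes from an element of height `m - 1`, so it has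
the parity of `m`, and for `U` of the same parity the bound holds for `U` as soon as `t i ≤ U` for
all lower `i`. -/
theorem signed_sum_last {N : ℕ} (r : Fin N → Fin N → Prop) (b : Fin N → Prop) (h t : Fin N → ℕ)
    (m U : ℕ) (ht : ∀ i j, r i j → nextBound (h i) (t i) ≤ t j)
    (hcov : ∀ i, b i → ∃ k, (i = k ∨ r i k) ∧ b k ∧ m = h k + 1)
    (hmin : (∀ i, ¬ b i) → Even m) :
    ∑ k ∈ range (U + 1) with ∀ i, b i → nextBound (h i) (t i) ≤ k, (-1 : ℤ) ^ k =
      if Even (U + m) ∧ ∀ i, b i → t i ≤ U then (-1) ^ m else 0 := by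
  -- every bound is dominated by the bound at an element just below, of height `m - 1`
  have hdom : ∀ i, b i → ∃ k, b k ∧ m = h k + 1 ∧
      nextBound (h i) (t i) ≤ nextBound (h k) (t k) := by
    intro i hi
    obtain ⟨k, hik, hk, hm⟩ := hcov i hi
    refine ⟨k, hk, hm, ?_⟩
    rcases hik with rfl | hik
    · exact le_rfl
    · exact (ht i k hik).trans (le_nextBound _ _)
  set L := ({i | b i} : Finset (Fin N)).sup fun i => nextBound (h i) (t i) with hLdef
  have hL : ∀ k, (∀ i, b i → nextBound (h i) (t i) ≤ k) ↔ L ≤ k := by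
    intro k
    simp [hLdef, Finset.sup_le_iff]
  have hpar : Even (L + m) := by
    by_cases hb : ∃ i, b i
    · obtain ⟨i0, hi0⟩ := hb
      obtain ⟨i, hi, hLi⟩ := exists_mem_eq_sup ({i | b i} : Finset (Fin N)) ⟨i0, by simpa using hi0⟩
        fun i => nextBound (h i) (t i)
      obtain ⟨k, hk, hm, hle⟩ := hdom i (by simpa using hi)
      have h1 : L = nextBound (h k) (t k) :=
        le_antisymm (hLdef.trans hLi ▸ hle) ((hL L).2 le_rfl k hk)
      rw [h1, hm, ← add_assoc]
      exact (odd_nextBound_add _ _).add_one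
    · push Not at hb
      have h1 : L = 0 := by
        rw [← Nat.le_zero, ← hL]
        exact fun i hi => absurd hi (hb i)
      rw [h1, zero_add]
      exact hmin hb
  rw [filter_congr fun k _ => hL k, sum_neg_one_pow_Icc]
  have hpow : (-1 : ℤ) ^ L = (-1) ^ m := neg_one_pow_congr (Nat.even_add.1 hpar)
  rw [hpow]
  refine if_congr ?_ rfl rfl
  have hUL : Even (U + L) ↔ Even (U + m) := by
    rw [Nat.even_add, Nat.even_add, Nat.even_add.1 hpar]
  rw [hUL, and_comm]
  refine and_congr_right fun hU => ?_
  rw [← hL]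
  refine ⟨fun h1 i hi => (le_nextBound _ _).trans (h1 i hi), fun h1 i hi => ?_⟩
  obtain ⟨k, hk, hm, hle⟩ := hdom i hi
  refine hle.trans (nextBound_le_iff.2 ⟨h1 k hk, fun hev => lt_of_le_of_ne (h1 k hk) ?_⟩)
  rintro rfl
  rw [hm, ← add_assoc] at hU
  exact Nat.not_even_iff_odd.2 hev.add_one hU

/-- The signed count of the maps `t ≤ u` that occur in the expansion at a virtual alphabet, for a
ranked poset whose elements are listed in an order `0, …, N - 1` compatible with its order relation
`r`. Summing over the value at the last element reduces `N` by one and replaces `u i` by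
`min (u i) (u (N - 1))` at the elements below the last one. -/
theorem signed_sum_fin (N : ℕ) (r : Fin N → Fin N → Prop) (h : Fin N → ℕ)
    (hlt : ∀ i j, r i j → i < j)
    (hcov : ∀ i j, r i j → ∃ k, (i = k ∨ r i k) ∧ r k j ∧ h j = h k + 1)
    (hmin : ∀ j, (∀ i, ¬ r i j) → Even (h j)) (u : Fin N → ℕ) :
    ∑ t ∈ Fintype.piFinset fun i => range (u i + 1) with
        ∀ i j, r i j → nextBound (h i) (t i) ≤ t j, ∏ i, (-1 : ℤ) ^ t i =
      if (∀ i, Even (u i + h i)) ∧ ∀ i j, r i j → u i ≤ u j then ∏ i, (-1) ^ h i else 0 := by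
  induction N with
  | zero => simp [filter_true_of_mem]
  | succ N ih =>
    set v := Fin.last N
    have hv : ∀ j, ¬ r v j := fun j hj => (hlt _ _ hj).not_ge (Fin.le_last j)
    set r' : Fin N → Fin N → Prop := fun i j => r i.castSucc j.castSucc
    set b : Fin N → Prop := fun i => r i.castSucc v
    set h' : Fin N → ℕ := fun i => h i.castSucc
    set u' : Fin N → ℕ := fun i => if b i then min (u i.castSucc) (u v) else u i.castSucc with hu'
    have hall : ∀ p : Fin (N + 1) → Fin (N + 1) → Prop, (∀ i j, r i j → p i j) ↔
        (∀ i j, r' i j → p i.castSucc j.castSucc) ∧ ∀ i, b i → p i.castSucc v := by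
      intro p
      refine ⟨fun hp => ⟨fun i j => hp _ _, fun i => hp _ _⟩, fun ⟨h1, h2⟩ i j => ?_⟩
      induction i using Fin.lastCases with
      | last => exact fun hij => absurd hij (hv j)
      | cast i =>
        induction j using Fin.lastCases with
        | last => exact h2 i
        | cast j => exact h1 i j
    have hcov' : ∀ i, b i → ∃ k, (i = k ∨ r' i k) ∧ b k ∧ h v = h' k + 1 := by
      intro i hi
      obtain ⟨k, hik, hk, hm⟩ := hcov _ _ hi
      induction k using Fin.lastCases with
      | last => exact absurd hk (hv _)
      | cast k => exact ⟨k, hik.imp_left fun h' => Fin.castSucc_injective _ h', hk, hm⟩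
    have hminv : (∀ i, ¬ b i) → Even (h v) := by
      intro hb
      refine hmin v fun i => ?_
      induction i using Fin.lastCases with
      | last => exact hv _
      | cast i => exact hb i
    have ih' := ih r' h' (fun i j hij => hlt _ _ hij)
      (by
        intro i j hij
        obtain ⟨k, hik, hk, hm⟩ := hcov _ _ hij
        induction k using Fin.lastCases with
        | last => exact absurd hk (hv _)
        | cast k => exact ⟨k, hik.imp_left fun h' => Fin.castSucc_injective _ h', hk, hm⟩)
      (by
        intro j hj
        refine hmin _ fun i hij => ?_
        induction i using Fin.lastCases with
        | last => exact hv _ hij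
        | cast i => exact hj i hij) u'
    -- separate the value at the last element
    have hsplit : ∑ t ∈ Fintype.piFinset fun i => range (u i + 1) with
        ∀ i j, r i j → nextBound (h i) (t i) ≤ t j, ∏ i, (-1 : ℤ) ^ t i =
        ∑ t ∈ Fintype.piFinset fun i : Fin N => range (u i.castSucc + 1) with
          ∀ i j, r' i j → nextBound (h' i) (t i) ≤ t j,
          ∑ k ∈ range (u v + 1) with ∀ i, b i → nextBound (h' i) (t i) ≤ k,
            (∏ i, (-1 : ℤ) ^ t i) * (-1) ^ k := by
      rw [sum_sigma']
      refine sum_bij' (fun t _ => ⟨fun i => t i.castSucc, t v⟩)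
        (fun s _ => Fin.snoc (α := fun _ => ℕ) s.1 s.2) ?_ ?_ ?_ ?_ ?_
      · intro t ht
        rw [mem_filter, hall] at ht
        simp only [mem_sigma, mem_filter, Fintype.mem_piFinset] at ht ⊢
        exact ⟨⟨fun i => ht.1 _, ht.2.1⟩, ht.1 _, ht.2.2⟩
      · rintro ⟨t, k⟩ hs
        rw [mem_filter, hall]
        simp only [mem_sigma, mem_filter, Fintype.mem_piFinset] at hs ⊢
        refine ⟨fun i => ?_, fun i j => ?_, fun i => ?_⟩
        · induction i using Fin.lastCases with
          | last => simpa using hs.2.1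
          | cast i => simpa using hs.1.1 i
        · simpa using hs.1.2 i j
        · simpa [v] using hs.2.2 i
      · intro t _
        funext i
        induction i using Fin.lastCases with
        | last => simp [v]
        | cast i => simp
      · rintro ⟨t, k⟩ _
        simp [v]
      · intro t _
        rw [Fin.prod_univ_castSucc]
    have hinner : ∀ t ∈ Fintype.piFinset fun i : Fin N => range (u i.castSucc + 1),
        (∀ i j, r' i j → nextBound (h' i) (t i) ≤ t j) →
        ∑ k ∈ range (u v + 1) with ∀ i, b i → nextBound (h' i) (t i) ≤ k,
            (∏ i, (-1 : ℤ) ^ t i) * (-1) ^ k =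
          if Even (u v + h v) ∧ ∀ i, b i → t i ≤ u v then (∏ i, (-1 : ℤ) ^ t i) * (-1) ^ h v
          else 0 := by
      intro t _ htv
      rw [← mul_sum, signed_sum_last r' b h' t (h v) (u v) htv hcov' hminv, mul_ite, mul_zero]
    rw [hsplit, sum_congr rfl fun t ht => hinner t (mem_filter.1 ht).1 (mem_filter.1 ht).2]
    by_cases hpar : Even (u v + h v)
    swap
    · rw [if_neg fun h1 => hpar (h1.1 v)]
      exact sum_eq_zero fun t _ => if_neg fun h1 => hpar h1.1
    simp only [hpar, true_and]
    rw [← sum_filter, filter_filter, ← sum_mul]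
    have hset : (Fintype.piFinset fun i : Fin N => range (u i.castSucc + 1)).filter
        (fun t => (∀ i j, r' i j → nextBound (h' i) (t i) ≤ t j) ∧ ∀ i, b i → t i ≤ u v) =
        (Fintype.piFinset fun i => range (u' i + 1)).filter
          (fun t => ∀ i j, r' i j → nextBound (h' i) (t i) ≤ t j) := by
      ext t
      simp only [mem_filter, Fintype.mem_piFinset, mem_range, Nat.lt_add_one_iff, hu']
      have : (∀ i, t i ≤ if b i then min (u i.castSucc) (u v) else u i.castSucc) ↔
          (∀ i, t i ≤ u i.castSucc) ∧ ∀ i, b i → t i ≤ u v := by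
        rw [← forall_and]
        refine forall_congr' fun i => ?_
        split_ifs with hb <;> simp [hb]
      rw [this]
      tauto
    rw [hset, ih', Fin.prod_univ_castSucc, ite_mul, zero_mul]
    refine if_congr ?_ rfl rfl
    rw [hall]
    constructor
    · rintro ⟨h1, h2⟩
      -- parity forces `u' = u` just below the last element, hence everywhere
      have hlt' : ∀ i, b i → u i.castSucc ≤ u v := by
        intro i hi
        obtain ⟨k, hik, hk, hm⟩ := hcov' i hi
        have hk1 : u' k < u v := by
          refine lt_of_le_of_ne (by simp only [hu', if_pos hk]; exact min_le_right _ _) ?_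
          intro heq
          have h3 := h1 k
          rw [heq] at h3
          rw [hm, ← add_assoc] at hpar
          exact Nat.not_even_iff_odd.2 h3.add_one hpar
        have hi1 : u' i < u v := by
          rcases hik with rfl | hik
          · exact hk1
          · exact (h2 i k hik).trans_lt hk1
        simp only [hu', if_pos hi] at hi1
        omega
      have hueq : ∀ i, u' i = u i.castSucc := by
        intro i
        simp only [hu']
        split_ifs with hb
        · exact min_eq_left (hlt' i hb)
        · rfl
      refine ⟨fun i => ?_, fun i j hij => ?_, hlt'⟩
      · induction i using Fin.lastCases with
        | last => exact hpar
        | cast i => rw [← hueq]; exact h1 i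
      · rw [← hueq, ← hueq]
        exact h2 i j hij
    · rintro ⟨h1, h2, h3⟩
      have hueq : ∀ i, u' i = u i.castSucc := by
        intro i
        simp only [hu']
        split_ifs with hb
        · exact min_eq_left (h3 i hb)
        · rfl
      simp only [hueq]
      exact ⟨fun i => h1 _, h2⟩

/-- The signed count of the maps `t ≤ u` that occur in the expansion at a virtual alphabet. -/
theorem signed_sum {P : Type*} [PartialOrder P] [Fintype P] (h : P → ℕ)
    (hcov : ∀ x y : P, x < y → ∃ z, x ≤ z ∧ z < y ∧ h y = h z + 1)
    (hmin : ∀ y : P, IsMin y → Even (h y)) (u : P → ℕ) :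
    ∑ t ∈ Fintype.piFinset fun v => range (u v + 1) with
        Monotone t ∧ ∀ a b, a < b → Even (t a + h a) → t a < t b, ∏ v, (-1 : ℤ) ^ t v =
      if (∀ v, Even (u v + h v)) ∧ Monotone u then ∏ v, (-1) ^ h v else 0 := by
  obtain ⟨e, hmono⟩ : ∃ e : Fin (Fintype.card P) ≃ P, ∀ i j, e i < e j → i < j := by
    let _ : Fintype (LinearExtension P) := inferInstanceAs (Fintype P)
    let o : Fin (Fintype.card P) ≃o LinearExtension P :=
      Fintype.orderIsoFinOfCardEq (LinearExtension P) rfl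
    refine ⟨o.toEquiv, fun i j hij => ?_⟩
    have hto : ∀ a b : P, a < b → toLinearExtension a ≤ toLinearExtension b :=
      fun a b hab => toLinearExtension.monotone hab.le
    have h1 : o i ≤ o j := hto _ _ hij
    refine lt_of_le_of_ne (o.le_iff_le.1 h1) ?_
    rintro rfl
    exact lt_irrefl (α := P) _ hij
  have key := signed_sum_fin (Fintype.card P) (fun i j => e i < e j) (h ∘ e) hmono
    (by
      intro i j hij
      obtain ⟨z, h1, h2, h3⟩ := hcov _ _ hij
      refine ⟨e.symm z, ?_, by simpa using h2, by simpa using h3⟩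
      rcases h1.eq_or_lt with rfl | h1
      · simp
      · exact Or.inr (by simpa using h1))
    (by
      intro j hj
      refine hmin _ fun x hx => ?_
      by_contra hx'
      exact hj (e.symm x) (by simpa using lt_of_le_not_ge hx hx')) (u ∘ e)
  have hrel : ∀ p : P → P → Prop, (∀ i j, e i < e j → p (e i) (e j)) ↔ ∀ a b, a < b → p a b :=
    fun p => (e.forall_congr_left (p := fun i => ∀ j, e i < e j → p (e i) (e j))).trans
      (forall_congr' fun a => by
        rw [e.forall_congr_left]
        simp)
  have hmon : ∀ f : P → ℕ, Monotone f ↔ ∀ a b, a < b → f a ≤ f b :=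
    fun f => monotone_iff_forall_lt.trans ⟨fun h a b => @h a b, fun h a b => h a b⟩
  refine Eq.trans ?_ (key.trans ?_)
  swap
  · refine if_congr (and_congr ?_ ?_) (Equiv.prod_comp e fun v => (-1 : ℤ) ^ h v) rfl
    · exact ⟨fun h1 v => by simpa using h1 (e.symm v), fun h1 i => h1 (e i)⟩
    · exact (hrel fun a b => u a ≤ u b).trans (hmon u).symm
  refine sum_bij' (fun t _ => t ∘ e) (fun t _ => t ∘ e.symm) ?_ ?_ ?_ ?_ ?_
  · intro t ht
    simp only [mem_filter, Fintype.mem_piFinset, Function.comp_apply, nextBound_le_iff] at ht ⊢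
    exact ⟨fun i => ht.1 _, fun i j hij => ⟨ht.2.1 hij.le, ht.2.2 _ _ hij⟩⟩
  · intro t ht
    simp only [mem_filter, Fintype.mem_piFinset, Function.comp_apply, nextBound_le_iff] at ht ⊢
    refine ⟨fun v => by simpa using ht.1 (e.symm v), (hmon _).2 fun a b hab => ?_,
      fun a b hab => ?_⟩
    · exact (ht.2 (e.symm a) (e.symm b) (by simpa using hab)).1
    · simpa using (ht.2 (e.symm a) (e.symm b) (by simpa using hab)).2
  · intro t _
    funext v
    simp
  · intro t _
    funext v
    simp
  · intro t _
    exact (Equiv.prod_comp e fun v => (-1 : ℤ) ^ t v).symm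

end SignedCount

/-! ### Expansion of `F_P` in the monomial basis -/

section Expansion

/-- The infinite sums that define coefficients of `F_P` and `N_P` count finite sets of maps. -/
theorem finsum_ite_eq_card {α : Type*} (p c : α → Prop) [DecidablePred c]
    (s : Finset α)
    (hs : ∀ a, a ∈ s ↔ p a ∧ c a) :
    ∑ᶠ a : {a // p a}, (if c a then (1 : ℚ) else 0) = #s := by
  rw [finsum_subtype_eq_finsum_cond (f := fun a => if c a then (1 : ℚ) else 0)]
  refine (finsum_mem_eq_sum_of_inter_support_eq (s := {a | p a}) (t := s) _ ?_).trans ?_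
  · ext a
    simp only [Set.mem_inter_iff, Set.mem_ofPred_eq, Function.mem_support, mem_coe, hs]
    by_cases hc : c a <;> simp [hc]
  · rw [sum_congr rfl fun a ha => if_pos ((hs a).1 ha).2]
    simp

theorem coeff_prod_X {σ ι : Type*} [DecidableEq σ] [Fintype ι] (f : ι → σ) (d : σ →₀ ℕ) :
    MvPowerSeries.coeff d (∏ v, (MvPowerSeries.X (f v) : MvPowerSeries σ ℚ)) =
      if d = ∑ v, Finsupp.single (f v) 1 then 1 else 0 := by
  simp only [MvPowerSeries.X, MvPowerSeries.prod_monomial, prod_const_one]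
  exact MvPowerSeries.coeff_monomial _ _ _

theorem eq_sum_single_iff {ι : Type*} [Fintype ι] (r : ι → ℕ) (d : ℕ →₀ ℕ) :
    d = ∑ v, Finsupp.single (r v) 1 ↔ ∀ a, #{v | r v = a} = d a := by
  rw [DFunLike.ext_iff]
  refine forall_congr' fun a => ?_
  rw [Finsupp.finsetSum_apply]
  simp only [Finsupp.single_apply, sum_boole, Nat.cast_id]
  exact eq_comm

/-- The composition `(d_{a_1}, …, d_{a_r})` formed by the exponents of a monomial `d` with support
`a_1 < ⋯ < a_r`. -/
def expComp (d : ℕ →₀ ℕ) : Comp :=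
  List.ofFn fun k : Fin #d.support =>
    ⟨d (d.support.orderIsoOfFin rfl k),
      Nat.pos_of_ne_zero (Finsupp.mem_support_iff.1 (d.support.orderIsoOfFin rfl k).2)⟩

theorem length_expComp (d : ℕ →₀ ℕ) : (expComp d).length = #d.support := List.length_ofFn

/-- Each monomial occurs in exactly one `M_J`, with coefficient `1`. -/
theorem coeff_monomialQSym (d : ℕ →₀ ℕ) (J : Comp) :
    MvPowerSeries.coeff d (monomialQSym J) = if J = expComp d then 1 else 0 := by
  have key : ∀ a : Fin J.length ↪o ℕ,
      MvPowerSeries.coeff d (∏ k, (MvPowerSeries.X (a k) : MvPowerSeries ℕ ℚ) ^ (J.get k : ℕ))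
        = if d = ∑ k, Finsupp.single (a k) (J.get k : ℕ) then 1 else 0 := by
    intro a
    simp only [MvPowerSeries.X_pow_eq, MvPowerSeries.prod_monomial, prod_const_one,
      MvPowerSeries.coeff_monomial]
  change (∑ᶠ a : Fin J.length ↪o ℕ, MvPowerSeries.coeff d _) = _
  simp only [key]
  -- a monomial of `M_J` has exponent `d` only if `a` enumerates the support of `d`
  have huniq : ∀ (n : ℕ) (hn : #d.support = n) (f : Fin n → ℕ+) (a : Fin n ↪o ℕ),
      d = ∑ k, Finsupp.single (a k) (f k : ℕ) ↔
        (∀ k, a k = d.support.orderIsoOfFin hn k) ∧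
          ∀ k, (f k : ℕ) = d (d.support.orderIsoOfFin hn k) := by
    intro n hn f a
    constructor
    · intro h
      have ha : ∀ k, a k = d.support.orderIsoOfFin hn k := by
        have hr : Set.range a = Set.range (d.support.orderEmbOfFin hn) := by
          rw [range_orderEmbOfFin, ← support_sum_single f a, ← h]
        exact fun k => congrFun ((StrictMono.range_inj a.strictMono
          (d.support.orderEmbOfFin hn).strictMono).1 hr) k
      refine ⟨ha, fun k => ?_⟩
      rw [← sum_single_apply f a k, ← ha]
      exact (DFunLike.congr_fun h (a k)).symm
    · rintro ⟨ha, hf⟩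
      ext i
      rw [Finsupp.finsetSum_apply]
      by_cases hi : i ∈ d.support
      · obtain ⟨k, hk⟩ := (d.support.orderIsoOfFin hn).surjective ⟨i, hi⟩
        have hki : a k = i := by rw [ha, hk]
        rw [sum_eq_single k]
        · rw [hki, Finsupp.single_eq_same, hf, hk]
        · intro b _ hb
          rw [Finsupp.single_apply, if_neg]
          rw [← hki]
          exact fun h => hb (a.injective h)
        · simp
      · rw [Finsupp.notMem_support_iff.1 hi, sum_eq_zero]
        intro k _
        rw [Finsupp.single_apply, if_neg]
        rintro rfl
        rw [ha] at hi
        exact hi (d.support.orderIsoOfFin hn k).2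
  have hcard : ∀ a : Fin J.length ↪o ℕ, d = ∑ k, Finsupp.single (a k) (J.get k : ℕ) →
      #d.support = J.length := by
    intro a h
    have h1 := support_sum_single J.get a
    rw [← h] at h1
    have h2 := Set.ncard_range_of_injective a.injective
    rw [← h1, Set.ncard_coe_finset] at h2
    simpa using h2
  have hofFn : ∀ (n : ℕ) (hn : #d.support = n) (f : Fin n → ℕ+),
      List.ofFn f = expComp d ↔ ∀ k, (f k : ℕ) = d (d.support.orderIsoOfFin hn k) := by
    rintro _ rfl f
    refine List.ofFn_inj.trans (funext_iff.trans (forall_congr' fun k => ?_))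
    exact PNat.coe_injective.eq_iff.symm
  by_cases hJ : #d.support = J.length
  · have hcomp : J = expComp d ↔ ∀ k, (J.get k : ℕ) = d (d.support.orderIsoOfFin hJ k) := by
      rw [← hofFn _ hJ, List.ofFn_get]
    split_ifs with h
    · rw [finsum_eq_single _ (d.support.orderEmbOfFin hJ)]
      · exact if_pos ((huniq _ hJ _ _).2 ⟨fun _ => rfl, hcomp.1 h⟩)
      · intro a ha
        refine if_neg fun h' => ha ?_
        ext k
        exact ((huniq _ hJ _ _).1 h').1 k
    · exact finsum_eq_zero_of_forall_eq_zero fun a => if_neg fun h' =>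
        h (hcomp.2 ((huniq _ hJ _ _).1 h').2)
  · rw [finsum_eq_zero_of_forall_eq_zero fun a => if_neg fun h => hJ (hcard a h), if_neg]
    rintro rfl
    exact hJ (length_expComp d).symm

variable (P : Type*) [PartialOrder P] [Fintype P] [GradeMinOrder ℕ P]

/-- The maps `P → {0, …, r - 1}` satisfying the order condition whose fibres have the sizes
`i_1, …, i_r` prescribed by a composition `I`. -/
def compMaps (I : Comp) : Finset (P → ℕ) :=
  {t ∈ Fintype.piFinset fun _ => range I.length |
    OrderCondition P t ∧ ∀ j < I.length, #{v | t v = j} = (I.getD j 1 : ℕ)}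

variable {P}

theorem sum_eq_card_of_mem_compMaps {I : Comp} {t : P → ℕ} (ht : t ∈ compMaps P I) :
    (I.map fun i : ℕ+ => (i : ℕ)).sum = Fintype.card P := by
  obtain ⟨h1, -, h2⟩ := mem_filter.1 ht
  rw [← card_univ (α := P), card_eq_sum_card_fiberwise (f := t) (t := range I.length)
    (fun v _ => mem_coe.2 (Fintype.mem_piFinset.1 h1 v)), sum_range, ← Fin.sum_univ_fun_getElem]
  refine sum_congr rfl fun j _ => ?_
  rw [h2 j j.2, List.getD_eq_getElem _ _ j.2]

/-- Chains of lower sets from `∅` to `P` with steps of sizes `i_1, …, i_r` correspond to maps. -/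
theorem chainHom_ofList {R : Type*} [CommRing R] (I : Comp) :
    chainHom (fun v : P => grade ℕ v) R (MonoidAlgebra.single (FreeMonoid.ofList I) 1) ⊥ ⊤ =
      #(compMaps P I) := by
  rw [chainHom, MonoidAlgebra.lift_single, one_smul, FreeMonoid.lift_ofList]
  have hI : I = (List.range I.length).map fun j => I.getD j 1 := by
    refine List.ext_getElem (by simp) fun j h1 h2 => ?_
    rw [List.getElem_map, List.getElem_range, List.getD_eq_getElem _ _ h1]
  conv_lhs => rw [hI, List.map_map]
  refine (prod_layer_bot_top (fun j (S : Finset P) =>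
    if #S = (I.getD j 1 : ℕ) ∧ WeakOn (fun v => grade ℕ v) S then (1 : R) else 0) I.length).trans ?_
  simp only [prod_boole]
  rw [sum_boole, filter_filter, compMaps]
  congr 2
  refine filter_congr fun t ht => ?_
  simp only [mem_range, OrderCondition]
  constructor
  · rintro ⟨h1, h2⟩
    refine ⟨⟨h1, fun a b hab ho => lt_of_le_of_ne (h1 hab.le) fun heq => ?_⟩,
      fun j hj => (h2 j hj).1⟩
    have := (h2 (t a) (mem_range.1 (Fintype.mem_piFinset.1 ht a))).2 a (by simp) b (by simp [heq])
      hab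
    exact Nat.not_even_iff_odd.2 ho this
  · rintro ⟨⟨h1, h2⟩, h3⟩
    refine ⟨h1, fun j hj => ⟨h3 j hj, fun a ha b hb hab => ?_⟩⟩
    by_contra ho
    have := h2 a b hab (Nat.not_even_iff_odd.1 ho)
    rw [(mem_filter.1 ha).2, (mem_filter.1 hb).2] at this
    exact lt_irrefl _ this

/-- The coefficient of a monomial in `F_P` depends only on its sequence of nonzero exponents: the
values of `r` are relabelled by the order isomorphism from the support onto an initial segment of
`ℕ`. -/
theorem coeff_seriesF (d : ℕ →₀ ℕ) :
    MvPowerSeries.coeff d (seriesF P) = #(compMaps P (expComp d)) := by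
  change (∑ᶠ r : {r : P → ℕ // OrderCondition P r}, MvPowerSeries.coeff d _) = _
  simp only [coeff_prod_X]
  refine (finsum_ite_eq_card (OrderCondition P) (fun r => d = ∑ v, Finsupp.single (r v) 1)
    {r ∈ Fintype.piFinset fun _ => d.support |
      OrderCondition P r ∧ ∀ a, #{v | r v = a} = d a} ?_).trans ?_
  swap
  · congr 1
    set o := d.support.orderIsoOfFin rfl with ho
    have hlen : (expComp d).length = #d.support := length_expComp d
    have hget : ∀ j (hj : j < #d.support), ((expComp d).getD j 1 : ℕ) = d (o ⟨j, hj⟩) := by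
      intro j hj
      rw [List.getD_eq_getElem _ _ (hlen.symm ▸ hj)]
      exact congrArg PNat.val (List.getElem_ofFn _)
    have hlt : ∀ t ∈ compMaps P (expComp d), ∀ v, t v < #d.support := fun t ht v =>
      hlen ▸ mem_range.1 (Fintype.mem_piFinset.1 (mem_filter.1 ht).1 v)
    have hmem : ∀ r ∈ (Fintype.piFinset fun _ : P => d.support).filter
      (fun r => OrderCondition P r ∧ ∀ a, #{v | r v = a} = d a), ∀ v, r v ∈ d.support :=
      fun r hr v => Fintype.mem_piFinset.1 (mem_filter.1 hr).1 v
    refine card_bij' (fun r hr v => (o.symm ⟨r v, hmem r hr v⟩ : ℕ))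
      (fun t ht v => (o ⟨t v, hlt t ht v⟩ : ℕ)) ?_ ?_ ?_ ?_
    · intro r hr
      obtain ⟨-, ⟨h1, h2⟩, h3⟩ := mem_filter.1 hr
      refine mem_filter.2 ⟨Fintype.mem_piFinset.2 fun v => ?_, ⟨fun a b hab => ?_,
        fun a b hab hodd => ?_⟩, fun j hj => ?_⟩
      · rw [hlen]
        exact mem_range.2 (Fin.is_lt _)
      · exact o.symm.monotone (h1 hab)
      · exact o.symm.strictMono (h2 a b hab hodd)
      · rw [hlen] at hj
        rw [hget j hj, ← h3]
        congr 1
        refine filter_congr fun v _ => ?_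
        rw [← Subtype.ext_iff (a1 := ⟨r v, hmem r hr v⟩), ← o.symm_apply_eq, Fin.ext_iff]
    · intro t ht
      obtain ⟨-, ⟨h1, h2⟩, h3⟩ := mem_filter.1 ht
      refine mem_filter.2 ⟨Fintype.mem_piFinset.2 fun v => (o _).2, ⟨fun a b hab => ?_,
        fun a b hab hodd => ?_⟩, fun a => ?_⟩
      · exact o.monotone (h1 hab)
      · exact o.strictMono (h2 a b hab hodd)
      · by_cases ha : a ∈ d.support
        · have h4 := h3 (o.symm ⟨a, ha⟩) (hlen.symm ▸ Fin.is_lt _)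
          rw [hget _ (Fin.is_lt _)] at h4
          simp only [Fin.eta, OrderIso.apply_symm_apply] at h4
          rw [← h4]
          congr 1
          refine filter_congr fun v _ => ?_
          rw [← Subtype.ext_iff (a2 := ⟨a, ha⟩), ← o.eq_symm_apply, Fin.ext_iff]
        · rw [Finsupp.notMem_support_iff.1 ha, card_eq_zero, filter_eq_empty_iff]
          rintro v - rfl
          exact ha (o _).2
    · intro r hr
      funext v
      simp
    · intro t ht
      funext v
      simp
  · intro r
    rw [mem_filter, Fintype.mem_piFinset, eq_sum_single_iff, and_iff_right_iff_imp]
    rintro ⟨-, h⟩ v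
    rw [Finsupp.mem_support_iff, ← h]
    exact card_ne_zero_of_mem (mem_filter.2 ⟨mem_univ v, rfl⟩)

theorem finite_setOf_sum_eq (n : ℕ) :
    {I : Comp | (I.map fun i : ℕ+ => (i : ℕ)).sum = n}.Finite := by
  refine Set.Finite.of_finite_image (f := fun I : Comp => I.map fun i : ℕ+ => (i : ℕ))
    ((Set.finite_range fun c : Composition n => c.blocks).subset ?_)
    (List.map_injective_iff.2 PNat.coe_injective).injOn
  rintro _ ⟨I, hI, rfl⟩
  refine ⟨⟨_, ?_, hI⟩, rfl⟩
  intro i hi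
  obtain ⟨k, -, rfl⟩ := List.mem_map.1 hi
  exact k.2

theorem coe_monomialBasis (I : Comp) :
    (monomialBasis I : MvPowerSeries ℕ ℚ) = monomialQSym I :=
  congrArg Subtype.val (Module.Basis.span_apply linearIndependent_monomialQSym I)

/-- The compositions of `n`. -/
def compsOf (n : ℕ) : Finset Comp := (finite_setOf_sum_eq n).toFinset

theorem mem_compsOf {n : ℕ} {I : Comp} :
    I ∈ compsOf n ↔ (I.map fun i : ℕ+ => (i : ℕ)).sum = n := by
  simp [compsOf]

theorem compMaps_eq_empty {I : Comp} (hI : I ∉ compsOf (Fintype.card P)) : compMaps P I = ∅ :=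
  eq_empty_of_forall_notMem fun _ ht => hI (mem_compsOf.2 (sum_eq_card_of_mem_compMaps ht))

variable (P) in
/-- The expansion of `F_P` in the basis `(M_I)`. -/
theorem seriesF_eq_sum :
    seriesF P = ∑ I ∈ compsOf (Fintype.card P), (#(compMaps P I) : ℚ) • monomialQSym I := by
  ext d
  rw [coeff_seriesF, map_sum]
  simp only [map_smul, coeff_monomialQSym, smul_eq_mul, mul_ite, mul_one, mul_zero]
  rw [sum_ite_eq']
  split_ifs with h
  · rfl
  · rw [compMaps_eq_empty h, card_empty, Nat.cast_zero]

variable (P) in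
theorem seriesF_mem : seriesF P ∈ QSym := by
  rw [seriesF_eq_sum]
  exact Submodule.sum_mem _ fun I _ => Submodule.smul_mem _ _ (Submodule.subset_span ⟨I, rfl⟩)

theorem chainHom_apply_bot_top {R : Type*} [CommRing R] (f : NSym R) :
    chainHom (fun v : P => grade ℕ v) R f ⊥ ⊤ =
      ∑ I ∈ compsOf (Fintype.card P), f.coeff (FreeMonoid.ofList I) * #(compMaps P I) := by
  induction f using MonoidAlgebra.induction_linear with
  | zero => simp
  | add f g hf hg => simp [hf, hg, add_mul, sum_add_distrib]
  | single w r =>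
    have h1 : (MonoidAlgebra.single w r : NSym R) =
        r • MonoidAlgebra.single (FreeMonoid.ofList (FreeMonoid.toList w)) 1 := by
      simp
    rw [h1, map_smul, Matrix.smul_apply, chainHom_ofList]
    simp only [MonoidAlgebra.coeff_smul, MonoidAlgebra.coeff_single, Finsupp.smul_apply,
      Finsupp.single_apply, EmbeddingLike.apply_eq_iff_eq, smul_eq_mul, mul_ite, ite_mul, mul_one,
      mul_zero, zero_mul]
    rw [sum_ite_eq]
    split_ifs with h
    · rfl
    · rw [compMaps_eq_empty h, card_empty, Nat.cast_zero, mul_zero]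

variable (P) in
/-- The value of `F_P` at the virtual alphabet `⊖(x_1) ⊕ (x_2) ⊖ ⋯`, as a signed sum over maps. -/
theorem evalVirtual_seriesF {R : Type*} [CommRing R] [Algebra ℚ R] (n : ℕ) (x : ℕ → R) :
    evalVirtual n x ⟨seriesF P, seriesF_mem P⟩ =
      ∑ t ∈ Fintype.piFinset fun _ : P => range n with
          Monotone t ∧ ∀ a b, a < b → Even (t a + grade ℕ a) → t a < t b,
        ∏ v, (-1) ^ (t v + 1) * x (t v + 1) := by
  have h1 : (⟨seriesF P, seriesF_mem P⟩ : QSym) =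
      ∑ I ∈ compsOf (Fintype.card P), (#(compMaps P I) : ℚ) • monomialBasis I := by
    refine Subtype.ext ?_
    rw [Submodule.coe_sum]
    refine (seriesF_eq_sum P).trans (sum_congr rfl fun I _ => ?_)
    rw [Submodule.coe_smul, coe_monomialBasis]
  rw [← chainHom_virtualProduct, chainHom_apply_bot_top, h1, map_sum]
  refine sum_congr rfl fun I hI => ?_
  rw [map_smul, evalVirtual, Module.Basis.constr_basis, monomialVirtual, mem_compsOf.1 hI,
    Algebra.smul_def, map_natCast, mul_comm]

end Expansion

/-! ### Alternating maps -/

section Alternating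

variable (P : Type*) [PartialOrder P] [GradeMinOrder ℕ P]

/-- Monotone maps from `P` to the positions `0, 1, 2, …` of the letters `p_1, q_1, p_2, q_2, …`,
which send elements of even height to letters `p` and elements of odd height to letters `q`. -/
def IsAlternating (u : P → ℕ) : Prop := (∀ v, Even (u v + grade ℕ v)) ∧ Monotone u

variable {P}

theorem even_grade_of_isMin (y : P) (hy : IsMin y) : Even (grade ℕ y) := by
  have : grade ℕ y = 0 := by simpa using hy.grade ℕ
  rw [this]
  exact Even.zero

/-- Alternating maps are the maps satisfying the order condition, the letter at `v` being `p_{r(v)}`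
or `q_{r(v)}`. The strict inequalities need no separate requirement: between `a` of odd height and
`b > a` there is an element of even height at most `b`. -/
theorem isAlternating_iff (u : P → ℕ) :
    IsAlternating P u ↔ ∃ r, OrderCondition P r ∧ u = fun v => 2 * r v + grade ℕ v % 2 := by
  constructor
  · rintro ⟨h1, h2⟩
    have hu : ∀ v, u v = 2 * (u v / 2) + grade ℕ v % 2 := by
      intro v
      have := Nat.even_iff.1 (h1 v)
      omega
    refine ⟨fun v => u v / 2, ⟨fun a b hab => Nat.div_le_div_right (h2 hab), ?_⟩, funext hu⟩
    intro a b hab hodd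
    -- some `z` just above `a` has even height
    obtain ⟨z, haz, hzb⟩ := exists_covBy_le_of_lt hab
    have h3 := h2 haz.lt.le
    have h4 := h2 hzb
    have h5 := Order.covBy_iff_add_one_eq.1 (haz.grade ℕ)
    have h6 := hu a
    have h7 := hu z
    rw [Nat.odd_iff] at hodd
    dsimp only
    omega
  · rintro ⟨r, ⟨h1, h2⟩, rfl⟩
    refine ⟨fun v => Nat.even_iff.2 (by dsimp only; omega), fun a b hab => ?_⟩
    rcases hab.lt_or_eq with hlt | rfl
    · have h3 := h1 hab
      rcases Nat.even_or_odd (grade ℕ a) with he | ho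
      · rw [Nat.even_iff] at he
        dsimp only
        omega
      · have := h2 a b hlt ho
        dsimp only
        omega
    · exact le_rfl

variable [Fintype P]

variable (P) in
/-- The alternating maps with values below `n`. -/
def alternatingMaps (n : ℕ) : Finset (P → ℕ) :=
  {u ∈ Fintype.piFinset fun _ => range n | IsAlternating P u}

theorem exists_grade_eq_add_one (x y : P) (hxy : x < y) :
    ∃ z, x ≤ z ∧ z < y ∧ grade ℕ y = grade ℕ z + 1 := by
  obtain ⟨z, hxz, hz⟩ := exists_le_covBy_of_lt hxy
  exact ⟨z, hxz, hz.lt, (Order.covBy_iff_add_one_eq.1 (hz.grade ℕ)).symm⟩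

theorem prod_neg_one_pow_grade {R : Type*} [CommRing R] :
    ∏ v : P, (-1 : R) ^ (grade ℕ v + 1) = (-1) ^ cardEven P := by
  have h1 : ∀ v : P, (-1 : R) ^ (grade ℕ v + 1) = if Even (grade ℕ v) then -1 else 1 := by
    intro v
    split_ifs with hv
    · exact hv.add_one.neg_one_pow
    · exact (Nat.not_even_iff_odd.1 hv).add_one.neg_one_pow
  rw [prod_congr rfl fun v _ => h1 v, prod_ite, prod_const_one, mul_one, prod_const, cardEven,
    Nat.card_eq_fintype_card, Fintype.card_subtype]

variable (P) in
/-- For the tail sums `x_{j+1} = y_j + ⋯ + y_{n-1}`, the value of `F_P` at `⊖(x_1) ⊕ (x_2) ⊖ ⋯` is,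
up to sign, the generating polynomial of the alternating maps. -/
theorem evalVirtual_seriesF_tail {R : Type*} [CommRing R] [Algebra ℚ R] (n : ℕ) (x y : ℕ → R)
    (hxy : ∀ j, x (j + 1) = ∑ k ∈ range n with j ≤ k, y k) :
    evalVirtual n x ⟨seriesF P, seriesF_mem P⟩ =
      (-1) ^ cardEven P * ∑ u ∈ alternatingMaps P n, ∏ v, y (u v) := by
  rw [evalVirtual_seriesF]
  -- expand every `x` as a sum of `y`'s, and sum over `t ≤ u` first
  have h1 : ∀ t : P → ℕ, ∏ v, (-1) ^ (t v + 1) * x (t v + 1) =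
        ∑ u ∈ Fintype.piFinset fun _ : P => range n,
          if ∀ v, t v ≤ u v then (∏ v, (-1 : R) ^ (t v + 1)) * ∏ v, y (u v) else 0 := by
    intro t
    rw [prod_mul_distrib, prod_congr rfl fun v _ => hxy (t v), prod_univ_sum, ← sum_filter, mul_sum]
    refine sum_congr ?_ fun _ _ => rfl
    ext u
    simp only [Fintype.mem_piFinset, mem_filter, forall_and]
  rw [sum_congr rfl fun t _ => h1 t, sum_comm, mul_sum, alternatingMaps,
    sum_filter]
  refine sum_congr rfl fun u hu => ?_
  have h2 := congrArg (fun z : ℤ => (z : R) * ((-1) ^ Fintype.card P * ∏ v, y (u v)))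
    (signed_sum (fun v : P => grade ℕ v) exists_grade_eq_add_one even_grade_of_isMin u)
  have hsign : ∀ f : P → ℕ, ∏ v, (-1 : R) ^ (f v + 1) =
      (∏ v, (-1) ^ f v) * (-1) ^ Fintype.card P := by
    intro f
    simp only [pow_succ, prod_mul_distrib, prod_const, card_univ]
  rw [← sum_filter, filter_filter]
  have hset : (Fintype.piFinset fun _ : P => range n).filter (fun t =>
      (Monotone t ∧ ∀ a b, a < b → Even (t a + grade ℕ a) → t a < t b) ∧ ∀ v, t v ≤ u v) =
      (Fintype.piFinset fun v => range (u v + 1)).filter (fun t =>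
        Monotone t ∧ ∀ a b, a < b → Even (t a + grade ℕ a) → t a < t b) := by
    ext t
    simp only [mem_filter, Fintype.mem_piFinset, mem_range, Nat.lt_add_one_iff] at hu ⊢
    constructor
    · rintro ⟨-, h3, h4⟩
      exact ⟨h4, h3⟩
    · rintro ⟨h4, h3⟩
      exact ⟨fun v => (h4 v).trans_lt (hu v), h3, h4⟩
  rw [hset, ← prod_neg_one_pow_grade, hsign, ← sum_mul]
  simp only [hsign, ← sum_mul]
  simp only [Int.cast_sum, Int.cast_prod, Int.cast_pow, Int.cast_neg, Int.cast_one, Int.cast_ite,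
    Int.cast_zero] at h2
  rw [mul_assoc, h2]
  by_cases hu' : IsAlternating P u
  · rw [if_pos hu', if_pos (show (∀ v, Even (u v + grade ℕ v)) ∧ Monotone u from hu')]
    ring
  · rw [if_neg hu', if_neg (show ¬ ((∀ v, Even (u v + grade ℕ v)) ∧ Monotone u) from hu'), zero_mul]

end Alternating

/-! ### The specializations of `N_P` -/

section Specialization

/-- The letters of the alphabet `p_1, q_1, p_2, q_2, …`, numbered from `0`. -/
def letter (k : ℕ) : ℕ ⊕ ℕ := if Even k then Sum.inl (k / 2) else Sum.inr (k / 2)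

/-- The first `2m + 1` letters `p_1, q_1, …, p_m, q_m, p_{m+1}` as polynomials (and `0` after). -/
def letterX (m k : ℕ) : PQPoly m :=
  if h : k < 2 * m + 1 then
    if he : Even k then MvPolynomial.X (Sum.inl ⟨k / 2, by omega⟩)
    else MvPolynomial.X (Sum.inr ⟨k / 2, by rw [Nat.even_iff] at he; omega⟩)
  else 0

theorem exists_letterX_eq (m k : ℕ) (hk : k < 2 * m + 1) :
    ∃ i : Fin (m + 1) ⊕ Fin m, letterX m k = MvPolynomial.X i ∧
      (Fin.valEmbedding.sumMap Fin.valEmbedding : Fin (m + 1) ⊕ Fin m ↪ ℕ ⊕ ℕ) i = letter k := by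
  unfold letterX letter
  by_cases he : Even k
  · exact ⟨_, by rw [dif_pos hk, dif_pos he], by rw [if_pos he]; rfl⟩
  · exact ⟨_, by rw [dif_pos hk, dif_neg he], by rw [if_neg he]; rfl⟩

theorem lt_of_letter_eq {m k : ℕ} {i : Fin (m + 1) ⊕ Fin m}
    (h : (Fin.valEmbedding.sumMap Fin.valEmbedding : Fin (m + 1) ⊕ Fin m ↪ ℕ ⊕ ℕ) i = letter k) :
    k < 2 * m + 1 := by
  unfold letter at h
  rcases i with i | i
  · split_ifs at h with he
    · have h1 : (i : ℕ) = k / 2 := Sum.inl_injective h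
      rw [Nat.even_iff] at he
      omega
    · cases h
  · split_ifs at h with he
    · cases h
    · have h1 : (i : ℕ) = k / 2 := Sum.inr_injective h
      rw [Nat.even_iff] at he
      omega

theorem sum_range_two_mul_add_one {R : Type*} [AddCommMonoid R] (m : ℕ) (f : ℕ → R) :
    ∑ k ∈ range (2 * m + 1), f k =
      ∑ k : Fin m, f (2 * k + 1) + ∑ k : Fin (m + 1), f (2 * k) := by
  rw [← sum_range fun k => f (2 * k + 1), ← sum_range fun k => f (2 * k)]
  induction m with
  | zero => simp
  | succ m ih =>
    rw [show 2 * (m + 1) + 1 = 2 * m + 1 + 1 + 1 by ring, sum_range_succ, sum_range_succ, ih,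
      sum_range_succ (fun k => f (2 * k + 1)) m, sum_range_succ (fun k => f (2 * k)) (m + 1),
      show 2 * m + 1 + 1 = 2 * (m + 1) by ring, add_add_add_comm, ← add_assoc]

theorem xForm_eq (m j : ℕ) :
    xForm m (j + 1) = ∑ k ∈ range (2 * m + 1) with j ≤ k, letterX m k := by
  rw [sum_filter, sum_range_two_mul_add_one]
  have h1 : ∀ k : Fin m, letterX m (2 * k + 1) = MvPolynomial.X (Sum.inr k) := by
    intro k
    rw [letterX, dif_pos (by omega), dif_neg (by rw [Nat.even_iff]; omega)]
    congr 3
    omega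
  have h2 : ∀ k : Fin (m + 1), letterX m (2 * k) = MvPolynomial.X (Sum.inl k) := by
    intro k
    rw [letterX, dif_pos (by omega), dif_pos (by rw [Nat.even_iff]; omega)]
    congr 3
    omega
  simp only [h1, h2, ← sum_filter]
  unfold xForm
  dsimp only
  split_ifs with ho
  · rw [Nat.odd_iff] at ho
    congr 2 <;> ext k <;> simp only [mem_filter, mem_univ, true_and] <;> omega
  · rw [Nat.odd_iff] at ho
    congr 2 <;> ext k <;> simp only [mem_filter, mem_univ, true_and] <;> omega

variable (P : Type*) [PartialOrder P] [Fintype P] [GradeMinOrder ℕ P]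

/-- The coefficients of `N_P`, both products being combined into one over all elements of `P`. -/
theorem coeff_seriesN (d : ℕ ⊕ ℕ →₀ ℕ) :
    MvPowerSeries.coeff d (seriesN P) =
      ∑ᶠ r : {r : P → ℕ // OrderCondition P r},
        if d = ∑ v, Finsupp.single (letter (2 * r.1 v + grade ℕ v % 2)) 1 then (1 : ℚ) else 0 := by
  change (∑ᶠ r : {r : P → ℕ // OrderCondition P r}, MvPowerSeries.coeff d _) = _
  refine finsum_congr fun r => ?_
  rw [← coeff_prod_X]
  congr 1
  simp only [← Nat.not_even_iff_odd]
  rw [← prod_filter_mul_prod_filter_not univ (fun v : P => Even (grade ℕ v))]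
  congr 1
  · refine prod_congr rfl fun v hv => ?_
    have hv := Nat.even_iff.1 (mem_filter.1 hv).2
    rw [letter, if_pos (by rw [Nat.even_iff]; omega)]
    congr 2
    omega
  · refine prod_congr rfl fun v hv => ?_
    have hv := Nat.odd_iff.1 (Nat.not_even_iff_odd.1 (mem_filter.1 hv).2)
    rw [letter, if_neg (by rw [Nat.even_iff]; omega)]
    congr 2
    omega

/-- The specializations of `N_P` are polynomials, with one monomial for each alternating map. -/
theorem specialize_seriesN (m : ℕ) :
    specialize m (seriesN P) =
      ((∑ u ∈ alternatingMaps P (2 * m + 1), ∏ v, letterX m (u v) : PQPoly m) :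
        MvPowerSeries (Fin (m + 1) ⊕ Fin m) ℚ) := by
  ext e
  set ε : Fin (m + 1) ⊕ Fin m ↪ ℕ ⊕ ℕ := Fin.valEmbedding.sumMap Fin.valEmbedding
  rw [specialize, MvPowerSeries.coeff_killCompl, MvPolynomial.coeff_coe, MvPolynomial.coeff_sum,
    coeff_seriesN]
  have hcoeff : ∀ u ∈ alternatingMaps P (2 * m + 1),
      MvPolynomial.coeff e (∏ v, letterX m (u v)) =
        if Finsupp.embDomain ε e = ∑ v, Finsupp.single (letter (u v)) 1 then 1 else 0 := by
    intro u hu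
    choose i hi1 hi2 using fun v => exists_letterX_eq m (u v)
      (mem_range.1 (Fintype.mem_piFinset.1 (mem_filter.1 hu).1 v))
    have h1 : ∑ v, Finsupp.single (letter (u v)) 1 =
        Finsupp.embDomain ε (∑ v, Finsupp.single (i v) 1) := by
      have := map_sum (Finsupp.embDomain.addMonoidHom (M := ℕ) ε)
        (fun v => Finsupp.single (i v) 1) univ
      refine Eq.trans ?_ this.symm
      refine sum_congr rfl fun v _ => ?_
      rw [← hi2]
      exact (Finsupp.embDomain_single _ _ _).symm
    rw [prod_congr rfl fun v _ => hi1 v]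
    simp only [MvPolynomial.X]
    rw [← MvPolynomial.monomial_sum_one, MvPolynomial.coeff_monomial]
    refine if_congr ?_ rfl rfl
    rw [h1, Finsupp.embDomain_inj]
    exact eq_comm
  rw [sum_congr rfl hcoeff, sum_boole]
  have hdiv : ∀ r : P → ℕ, (fun v => (2 * r v + grade ℕ v % 2) / 2) = r := by
    intro r
    funext v
    omega
  refine (finsum_ite_eq_card (OrderCondition P) (fun r => Finsupp.embDomain ε e =
    ∑ v, Finsupp.single (letter (2 * r v + grade ℕ v % 2)) 1)
    (({u ∈ alternatingMaps P (2 * m + 1) | Finsupp.embDomain ε e =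
      ∑ v, Finsupp.single (letter (u v)) 1} : Finset (P → ℕ)).image fun u v => u v / 2) ?_).trans ?_
  · intro r
    simp only [mem_image, mem_filter, alternatingMaps, Fintype.mem_piFinset, mem_range]
    constructor
    · rintro ⟨u, ⟨⟨-, hu⟩, hd⟩, rfl⟩
      obtain ⟨r, hr, rfl⟩ := (isAlternating_iff u).1 hu
      rw [hdiv]
      exact ⟨hr, hd⟩
    · rintro ⟨hr, hd⟩
      refine ⟨_, ⟨⟨fun v => ?_, (isAlternating_iff _).2 ⟨r, hr, rfl⟩⟩, hd⟩, hdiv r⟩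
      -- the letters that occur in `d` lie in the finite alphabet
      by_contra hv
      have h1 : Finsupp.embDomain ε e (letter (2 * r v + grade ℕ v % 2)) = 0 :=
        Finsupp.embDomain_of_notMem_range _ _ _ fun ⟨i, hi⟩ => hv (lt_of_letter_eq hi)
      rw [hd, Finsupp.finsetSum_apply, sum_eq_zero_iff] at h1
      simpa using h1 v (mem_univ v)
  · rw [card_image_of_injOn]
    intro u hu u' hu' huu
    obtain ⟨r, -, rfl⟩ := (isAlternating_iff u).1 (mem_filter.1 (mem_filter.1 hu).1).2
    obtain ⟨r', -, rfl⟩ := (isAlternating_iff u').1 (mem_filter.1 (mem_filter.1 hu').1).2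
    have huu : (fun v => (2 * r v + grade ℕ v % 2) / 2) =
      fun v => (2 * r' v + grade ℕ v % 2) / 2 := huu
    rw [hdiv, hdiv] at huu
    rw [huu]

theorem neg_one_pow_mul_evalX (m : ℕ) :
    (-1 : PQPoly m) ^ cardEven P * evalX m ⟨seriesF P, seriesF_mem P⟩ =
      ∑ u ∈ alternatingMaps P (2 * m + 1), ∏ v, letterX m (u v) := by
  rw [evalX, evalVirtual_seriesF_tail P (2 * m + 1) (xForm m) (letterX m) (xForm_eq m), ← mul_assoc,
    ← mul_pow, neg_one_mul, neg_neg, one_pow, one_mul]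

theorem eq_of_specialize_eq {G H : MvPowerSeries (ℕ ⊕ ℕ) ℚ}
    (h : ∀ m, specialize m G = specialize m H) : G = H := by
  ext d
  set m := d.support.sup (fun i => Sum.elim id id i + 1) with hm
  have hd : (d.support : Set (ℕ ⊕ ℕ)) ⊆
      Set.range (Fin.valEmbedding.sumMap Fin.valEmbedding : Fin (m + 1) ⊕ Fin m ↪ ℕ ⊕ ℕ) := by
    intro i hi
    have h1 : Sum.elim id id i + 1 ≤ m :=
      le_sup (f := fun i : ℕ ⊕ ℕ => Sum.elim id id i + 1) (mem_coe.1 hi)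
    rcases i with i | i
    · have h1 : i + 1 ≤ m := h1
      exact ⟨Sum.inl ⟨i, by omega⟩, rfl⟩
    · have h1 : i + 1 ≤ m := h1
      exact ⟨Sum.inr ⟨i, by omega⟩, rfl⟩
  rw [← Finsupp.embDomain_comapDomain hd, ← MvPowerSeries.coeff_killCompl,
    ← MvPowerSeries.coeff_killCompl]
  exact congrArg _ (h m)

theorem grade_mem_alternatingMaps {m : ℕ} (hm : ∀ v : P, grade ℕ v ≤ m) :
    (fun v => grade ℕ v) ∈ alternatingMaps P (2 * m + 1) := by
  refine mem_filter.2 ⟨Fintype.mem_piFinset.2 fun v => mem_range.2 ?_, fun v => ⟨_, rfl⟩,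
    fun a b hab => grade_mono hab⟩
  have := hm v
  omega

theorem eval_one_sum_alternatingMaps (m : ℕ) :
    MvPolynomial.eval (fun _ => (1 : ℚ))
      (∑ u ∈ alternatingMaps P (2 * m + 1), ∏ v, letterX m (u v)) =
      #(alternatingMaps P (2 * m + 1)) := by
  rw [map_sum, sum_congr rfl (g := fun _ => (1 : ℚ)), sum_const, nsmul_one]
  intro u hu
  rw [map_prod]
  refine prod_eq_one fun v _ => ?_
  obtain ⟨i, hi, -⟩ := exists_letterX_eq m (u v)
    (mem_range.1 (Fintype.mem_piFinset.1 (mem_filter.1 hu).1 v))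
  rw [hi, MvPolynomial.eval_X]

/-- The sign `(-1)^|V_0|` is determined by `F_P`: it makes the specializations of `N_P`, which are
nonzero for large `m`, have nonnegative coefficients. -/
theorem neg_one_pow_cardEven_eq (Q : Type*) [PartialOrder Q] [Fintype Q] [GradeMinOrder ℕ Q]
    (h : seriesF Q = seriesF P) : (-1 : ℚ) ^ cardEven Q = (-1) ^ cardEven P := by
  set m := (univ.sup fun v : P => grade ℕ v) + univ.sup fun v : Q => grade ℕ v with hm
  have hP : ∀ v : P, grade ℕ v ≤ m := fun v =>
    (le_sup (f := fun v : P => grade ℕ v) (mem_univ v)).trans (Nat.le_add_right _ _)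
  have hQ : ∀ v : Q, grade ℕ v ≤ m := fun v =>
    (le_sup (f := fun v : Q => grade ℕ v) (mem_univ v)).trans (Nat.le_add_left _ _)
  have h1 := congrArg (MvPolynomial.eval fun _ => (1 : ℚ)) (neg_one_pow_mul_evalX P m)
  have h2 := congrArg (MvPolynomial.eval fun _ => (1 : ℚ)) (neg_one_pow_mul_evalX Q m)
  rw [eval_one_sum_alternatingMaps] at h1 h2
  have hF : (⟨seriesF Q, seriesF_mem Q⟩ : QSym) = ⟨seriesF P, seriesF_mem P⟩ := Subtype.ext h
  rw [hF] at h2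
  have h3 : (0 : ℚ) < #(alternatingMaps P (2 * m + 1)) :=
    Nat.cast_pos.2 (card_pos.2 ⟨_, grade_mem_alternatingMaps P hP⟩)
  have h4 : (0 : ℚ) < #(alternatingMaps Q (2 * m + 1)) :=
    Nat.cast_pos.2 (card_pos.2 ⟨_, grade_mem_alternatingMaps Q hQ⟩)
  rw [← h1] at h3
  rw [← h2] at h4
  simp only [map_mul, map_pow, map_neg, map_one] at h3 h4
  rcases neg_one_pow_eq_or ℚ (cardEven P) with h5 | h5 <;>
    rcases neg_one_pow_eq_or ℚ (cardEven Q) with h6 | h6 <;> rw [h5] at h3 <;> rw [h6] at h4 <;>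
    first | (rw [h5, h6]; done) | (exfalso; linarith)

end Specialization

end SuperQSym

end

theorem theorem1 (P : Type*) [PartialOrder P] [Fintype P] [GradeMinOrder ℕ P] :
    -- the series `F_P` is quasi-symmetric, and
    (∃ hF : SuperQSym.seriesF P ∈ SuperQSym.QSym,
      -- for all `m`, the specialization of `N_P` is `(-1)^|V_0| F_P(𝕏_m)`;
      (∀ m : ℕ,
        SuperQSym.specialize m (SuperQSym.seriesN P) =
          (((-1 : SuperQSym.PQPoly m) ^ SuperQSym.cardEven P *
              SuperQSym.evalX m ⟨SuperQSym.seriesF P, hF⟩ : SuperQSym.PQPoly m) :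
            MvPowerSeries (Fin (m + 1) ⊕ Fin m) ℚ)) ∧
      -- these specializations determine `N_P`
      (∀ G : MvPowerSeries (ℕ ⊕ ℕ) ℚ,
        (∀ m : ℕ,
          SuperQSym.specialize m G =
            (((-1 : SuperQSym.PQPoly m) ^ SuperQSym.cardEven P *
                SuperQSym.evalX m ⟨SuperQSym.seriesF P, hF⟩ : SuperQSym.PQPoly m) :
              MvPowerSeries (Fin (m + 1) ⊕ Fin m) ℚ)) →
        G = SuperQSym.seriesN P)) ∧
    -- in particular, `N_P` depends only on `F_P`
    (∀ (Q : Type*) [PartialOrder Q] [Fintype Q] [GradeMinOrder ℕ Q],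
      SuperQSym.seriesF Q = SuperQSym.seriesF P → SuperQSym.seriesN Q = SuperQSym.seriesN P) := by
  refine ⟨⟨SuperQSym.seriesF_mem P, fun m => ?_, fun G hG => ?_⟩, fun Q _ _ _ h => ?_⟩
  · rw [SuperQSym.neg_one_pow_mul_evalX, SuperQSym.specialize_seriesN]
  · refine SuperQSym.eq_of_specialize_eq fun m => ?_
    rw [hG, SuperQSym.neg_one_pow_mul_evalX, SuperQSym.specialize_seriesN]
  · refine SuperQSym.eq_of_specialize_eq fun m => ?_
    have hF : (⟨SuperQSym.seriesF Q, SuperQSym.seriesF_mem Q⟩ : SuperQSym.QSym) =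
        ⟨SuperQSym.seriesF P, SuperQSym.seriesF_mem P⟩ := Subtype.ext h
    have hsign : (-1 : SuperQSym.PQPoly m) ^ SuperQSym.cardEven Q =
        (-1) ^ SuperQSym.cardEven P := by
      have := congrArg (algebraMap ℚ (SuperQSym.PQPoly m))
        (SuperQSym.neg_one_pow_cardEven_eq P Q h)
      simpa only [map_pow, map_neg, map_one] using this
    rw [SuperQSym.specialize_seriesN, SuperQSym.specialize_seriesN,
      ← SuperQSym.neg_one_pow_mul_evalX, ← SuperQSym.neg_one_pow_mul_evalX, hF, hsign]
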